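/- Let $\mathbbm{k}$ be an algebraically closed field of characteristic zero. A Majid algebra (coquasi-Hopf algebra) is a coalgebra $M$ with a unital product whose product and unit are coalgebra maps, a convolution-invertible associator $\Phi\colon M^{\otimes 3}\to\mathbbm{k}$ with $a_1(b_1c_1)\Phi(a_2,b_2,c_2)=\Phi(a_1,b_1,c_1)(a_2b_2)c_2$, $\Phi(a_1,b_1,c_1d_1)\Phi(a_2b_2,c_2,d_2)=\Phi(b_1,c_1,d_1)\Phi(a_1,b_2c_2,d_2)\Phi(a_2,b_3,c_3)$, $\Phi(a,1,b)=\varepsilon(a)\varepsilon(b)$, and a quasi-antipode $(S,\alpha,\beta)$: $S\colon M\to M$ a coalgebra antimorphism, $\alpha,\beta\in M^*$, with $S(a_1)\alpha(a_2)a_3=\alpha(a)1$, $a_1\beta(a_2)S(a_3)=\beta(a)1$, $\Phi(a_1,S(a_3),a_5)\beta(a_2)\alpha(a_4)=\Phi^{-1}(S(a_1),a_3,S(a_5))\alpha(a_2)\beta(a_4)=\varepsilon(a)$. Let $M=\bigoplus_{n\ge 0}M(n)$ be a finite-dimensional graded pointed Majid algebra whose group-like elements form an abelian group $G$, generated as an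 algebra by $G$ and a set of skew-primitive elements. Here graded means: $\bigoplus_{i\le n}M(i)$ is the $n$-th term of the coradical filtration for every $n$, and all structure maps respect the grading (in particular $\Phi,\alpha,\beta$ vanish on homogeneous arguments that are not all of degree $0$). The quasi-antipode is normalized by $\alpha(g)=1$ for $g\in G$. Then $M(0)=\mathbbm{k}G$; let $\pi\colon M\to\mathbbm{k}G$ be the projection, and write $\Phi$ also for the restriction of $\Phi$ to $G^3$, a normalized $3$-cocycle. Let $R=\{X\in M\mid(\mathrm{id}\otimes\pi)\Delta(X)=X\otimes 1\}$, with the $G$-grading $R_g=\{X\in R\mid(\pi\otimes\mathrm{id})\Delta(X)=g\otimes X\}$; lower-case letters denote degrees of homogeneous elements. $R$ carries the product, unit and counit of $M$, the action $$f\triangleright X=\frac{\Phi(fx,f^{-1},f)}{\Phi(f,f^{-1},f)}(f\cdot X)\cdot f^{-1}\qquad(f\in G,\ X\in R_x),$$ the coproduct $\Delta_R(X)=\Phi(x_1,x_2,x_2^{-1})\,X_1\cdot x_2^{-1}\otimes X_2$, where $\Delta(X)=X_1\otimes X_2$ with $X_2$ of degree $x_2$ and $X_1\cdot x_2^{-1}$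 of degree $x_1$ for the left $\mathbbm{k}G$-coaction $(\pi\otimes\mathrm{id})\Delta$, and the antipode $S_R(X)=\Phi(x,x^{-1},x)^{-1}\,x\cdot S(X)$ for $X\in R_x$. Let $R\#\mathbbm{k}G$ be the vector space $R\otimes\mathbbm{k}G$ with unit $1\otimes 1$, counit $X\otimes g\mapsto\varepsilon(X)$, and, for homogeneous $X,Y,Z\in R$ and $g,h,e\in G$, $$(X\otimes g)(Y\otimes h)=\frac{\Phi(xg,y,h)\Phi(x,y,g)}{\Phi(x,g,y)\Phi(xy,g,h)}\,X(g\triangleright Y)\otimes gh,$$ $$\Delta(X\otimes g)=\Phi(x_1,x_2,g)^{-1}(X_1\otimes x_2g)\otimes(X_2\otimes g),\qquad \text{where }\Delta_R(X)=X_1\otimes X_2,$$ $$S(X\otimes g)=\frac{\Phi(g^{-1},g,g^{-1})}{\Phi(x^{-1}g^{-1},xg,g^{-1})\Phi(x,g,g^{-1})}(1\otimes x^{-1}g^{-1})(S_R(X)\otimes 1),$$ associator $(X\otimes g,Y\otimes h,Z\otimes e)\mapsto\varepsilon(X)\varepsilon(Y)\varepsilon(Z)\Phi(g,h,e)$, $\alpha(X\otimes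 g)=\varepsilon(X)$ and $\beta(X\otimes g)=\varepsilon(X)\Phi(g,g^{-1},g)^{-1}$. Then $R\#\mathbbm{k}G$ is a Majid algebra, and the linear map $F\colon R\#\mathbbm{k}G\to M$, $X\otimes g\mapsto X\cdot g$, is an isomorphism of Majid algebras: it is bijective and preserves product, unit, coproduct, counit, associator, $S$, $\alpha$ and $\beta$. -/

import Mathlib

open scoped TensorProduct

namespace QuasiBoson

/-! ### Majid algebras (coquasi-Hopf algebras) -/

section Majid

variable {k : Type*} [Field k] {V : Type*} [AddCommGroup V] [Module k V]

/-- The underlying data of a Majid algebra on the vector space `V`: comultiplication, counit,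
product, unit, associator `Φ` (a trilinear functional) and quasi-antipode `(S, α, β)`.
The axioms are in `MajidData.IsMajidAlgebra`. -/
structure MajidData (k : Type*) [Field k] (V : Type*) [AddCommGroup V] [Module k V] where
  comul : V →ₗ[k] V ⊗[k] V
  counit : V →ₗ[k] k
  mul : V →ₗ[k] V →ₗ[k] V
  one : V
  assoc : V →ₗ[k] V →ₗ[k] V →ₗ[k] k
  antipode : V →ₗ[k] V
  alpha : V →ₗ[k] k
  beta : V →ₗ[k] k

/-- A Sweedler presentation `Δ(a) = ∑ a₁ ⊗ a₂`. -/
structure Sweedler2 (δ : V →ₗ[k] V ⊗[k] V) (a : V) where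
  n : ℕ
  x₁ : Fin n → V
  x₂ : Fin n → V
  eq : δ a = ∑ i, x₁ i ⊗ₜ[k] x₂ i

/-- A Sweedler presentation `(id ⊗ Δ) Δ(a) = ∑ a₁ ⊗ (a₂ ⊗ a₃)`. -/
structure Sweedler3 (δ : V →ₗ[k] V ⊗[k] V) (a : V) where
  n : ℕ
  x₁ : Fin n → V
  x₂ : Fin n → V
  x₃ : Fin n → V
  eq : δ.lTensor V (δ a) = ∑ i, x₁ i ⊗ₜ[k] (x₂ i ⊗ₜ[k] x₃ i)

/-- A Sweedler presentation of the fourfold iterated comultiplication,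
`∑ a₁ ⊗ (a₂ ⊗ (a₃ ⊗ (a₄ ⊗ a₅)))`. -/
structure Sweedler5 (δ : V →ₗ[k] V ⊗[k] V) (a : V) where
  n : ℕ
  x₁ : Fin n → V
  x₂ : Fin n → V
  x₃ : Fin n → V
  x₄ : Fin n → V
  x₅ : Fin n → V
  eq : ((δ.lTensor V).lTensor V).lTensor V ((δ.lTensor V).lTensor V (δ.lTensor V (δ a))) =
    ∑ i, x₁ i ⊗ₜ[k] (x₂ i ⊗ₜ[k] (x₃ i ⊗ₜ[k] (x₄ i ⊗ₜ[k] x₅ i)))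

theorem exists_fin_sum {W : Type*} [AddCommGroup W] [Module k W] (t : V ⊗[k] W) :
    ∃ (n : ℕ) (x : Fin n → V) (y : Fin n → W), t = ∑ i, x i ⊗ₜ[k] y i := by
  obtain ⟨s, hs⟩ := TensorProduct.exists_finset t
  refine ⟨s.card, fun i => (s.equivFin.symm i).1.1, fun i => (s.equivFin.symm i).1.2, ?_⟩
  rw [hs, ← Finset.sum_coe_sort]
  exact (Equiv.sum_comp s.equivFin.symm (fun p : s => p.1.1 ⊗ₜ[k] p.1.2)).symm

theorem Sweedler2.nonempty (δ : V →ₗ[k] V ⊗[k] V) (a : V) : Nonempty (Sweedler2 δ a) := by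
  obtain ⟨n, x, y, h⟩ := exists_fin_sum (δ a)
  exact ⟨⟨n, x, y, h⟩⟩

/-- The axioms of a Majid algebra.  Identities in Sweedler notation are required for all
presentations of the (iterated) coproducts, equivalently for one choice of presentations. -/
structure MajidData.IsMajidAlgebra (A : MajidData k V) : Prop where
  /-- coalgebra axioms -/
  coassoc : TensorProduct.assoc k V V V ∘ₗ A.comul.rTensor V ∘ₗ A.comul =
    A.comul.lTensor V ∘ₗ A.comul
  counit_left : ∀ a, TensorProduct.lid k V (A.counit.rTensor V (A.comul a)) = a
  counit_right : ∀ a, TensorProduct.rid k V (A.counit.lTensor V (A.comul a)) = a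
  /-- the product and the unit are coalgebra maps -/
  comul_mul : ∀ (a b : V) (s : Sweedler2 A.comul a) (t : Sweedler2 A.comul b),
    A.comul (A.mul a b) =
      ∑ i, ∑ j, A.mul (s.x₁ i) (t.x₁ j) ⊗ₜ[k] A.mul (s.x₂ i) (t.x₂ j)
  counit_mul : ∀ a b, A.counit (A.mul a b) = A.counit a * A.counit b
  comul_one : A.comul A.one = A.one ⊗ₜ[k] A.one
  counit_one : A.counit A.one = 1
  one_mul : ∀ a, A.mul A.one a = a
  mul_one : ∀ a, A.mul a A.one = a
  /-- `a₁(b₁c₁) Φ(a₂,b₂,c₂) = Φ(a₁,b₁,c₁) (a₂b₂)c₂` -/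
  quasi_assoc : ∀ (a b c : V) (s : Sweedler2 A.comul a) (t : Sweedler2 A.comul b)
    (u : Sweedler2 A.comul c),
    ∑ i, ∑ j, ∑ l, A.assoc (s.x₂ i) (t.x₂ j) (u.x₂ l) •
        A.mul (s.x₁ i) (A.mul (t.x₁ j) (u.x₁ l)) =
      ∑ i, ∑ j, ∑ l, A.assoc (s.x₁ i) (t.x₁ j) (u.x₁ l) •
        A.mul (A.mul (s.x₂ i) (t.x₂ j)) (u.x₂ l)
  /-- `Φ(a₁,b₁,c₁d₁) Φ(a₂b₂,c₂,d₂) = Φ(b₁,c₁,d₁) Φ(a₁,b₂c₂,d₂) Φ(a₂,b₃,c₃)` -/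
  pentagon : ∀ (a b c d : V) (s : Sweedler2 A.comul a) (t : Sweedler2 A.comul b)
    (u : Sweedler2 A.comul c) (v : Sweedler2 A.comul d)
    (t' : Sweedler3 A.comul b) (u' : Sweedler3 A.comul c),
    ∑ i, ∑ j, ∑ l, ∑ m, A.assoc (s.x₁ i) (t.x₁ j) (A.mul (u.x₁ l) (v.x₁ m)) *
        A.assoc (A.mul (s.x₂ i) (t.x₂ j)) (u.x₂ l) (v.x₂ m) =
      ∑ i, ∑ j, ∑ l, ∑ m, A.assoc (t'.x₁ j) (u'.x₁ l) (v.x₁ m) *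
        A.assoc (s.x₁ i) (A.mul (t'.x₂ j) (u'.x₂ l)) (v.x₂ m) *
        A.assoc (s.x₂ i) (t'.x₃ j) (u'.x₃ l)
  assoc_one : ∀ a b, A.assoc a A.one b = A.counit a * A.counit b
  /-- `S` is a coalgebra antimorphism -/
  comul_antipode : ∀ a, A.comul (A.antipode a) =
    TensorProduct.comm k V V (TensorProduct.map A.antipode A.antipode (A.comul a))
  counit_antipode : ∀ a, A.counit (A.antipode a) = A.counit a
  /-- `S(a₁) α(a₂) a₃ = α(a) 1` -/
  antipode_alpha : ∀ (a : V) (s : Sweedler3 A.comul a),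
    ∑ i, A.alpha (s.x₂ i) • A.mul (A.antipode (s.x₁ i)) (s.x₃ i) = A.alpha a • A.one
  /-- `a₁ β(a₂) S(a₃) = β(a) 1` -/
  beta_antipode : ∀ (a : V) (s : Sweedler3 A.comul a),
    ∑ i, A.beta (s.x₂ i) • A.mul (s.x₁ i) (A.antipode (s.x₃ i)) = A.beta a • A.one
  /-- `Φ(a₁,S(a₃),a₅) β(a₂) α(a₄) = ε(a)` -/
  assoc_antipode : ∀ (a : V) (s : Sweedler5 A.comul a),
    ∑ i, A.assoc (s.x₁ i) (A.antipode (s.x₃ i)) (s.x₅ i) * A.beta (s.x₂ i) * A.alpha (s.x₄ i) =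
      A.counit a
  /-- `Φ` has a convolution inverse `Ψ`, and `Ψ(S(a₁),a₃,S(a₅)) α(a₂) β(a₄) = ε(a)` -/
  assoc_inv : ∃ Ψ : V →ₗ[k] V →ₗ[k] V →ₗ[k] k,
    (∀ (a b c : V) (s : Sweedler2 A.comul a) (t : Sweedler2 A.comul b)
      (u : Sweedler2 A.comul c),
      ∑ i, ∑ j, ∑ l, A.assoc (s.x₁ i) (t.x₁ j) (u.x₁ l) * Ψ (s.x₂ i) (t.x₂ j) (u.x₂ l) =
        A.counit a * A.counit b * A.counit c) ∧
    (∀ (a b c : V) (s : Sweedler2 A.comul a) (t : Sweedler2 A.comul b)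
      (u : Sweedler2 A.comul c),
      ∑ i, ∑ j, ∑ l, Ψ (s.x₁ i) (t.x₁ j) (u.x₁ l) * A.assoc (s.x₂ i) (t.x₂ j) (u.x₂ l) =
        A.counit a * A.counit b * A.counit c) ∧
    (∀ (a : V) (s : Sweedler5 A.comul a),
      ∑ i, Ψ (A.antipode (s.x₁ i)) (s.x₃ i) (A.antipode (s.x₅ i)) *
        A.alpha (s.x₂ i) * A.beta (s.x₄ i) = A.counit a)

/-- A linear isomorphism is an isomorphism of Majid algebras if it respects all the structure. -/
structure MajidData.IsIso {W : Type*} [AddCommGroup W] [Module k W]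
    (A : MajidData k V) (B : MajidData k W) (F : V ≃ₗ[k] W) : Prop where
  map_comul : ∀ a, B.comul (F a) = TensorProduct.map F.toLinearMap F.toLinearMap (A.comul a)
  map_counit : ∀ a, B.counit (F a) = A.counit a
  map_mul : ∀ a b, F (A.mul a b) = B.mul (F a) (F b)
  map_one : F A.one = B.one
  map_assoc : ∀ a b c, B.assoc (F a) (F b) (F c) = A.assoc a b c
  map_antipode : ∀ a, F (A.antipode a) = B.antipode (F a)
  map_alpha : ∀ a, B.alpha (F a) = A.alpha a
  map_beta : ∀ a, B.beta (F a) = A.beta a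

/-! ### Coradical filtration, pointedness, group-like and skew-primitive elements -/

/-- The subspace `P ⊗ Q` of `V ⊗ V`. -/
def tens (P Q : Submodule k V) : Submodule k (V ⊗[k] V) :=
  Submodule.map₂ (TensorProduct.mk k V V) P Q

/-- `D` is a subcoalgebra: `Δ(D) ⊆ D ⊗ D`. -/
def IsSubcoalgebra (δ : V →ₗ[k] V ⊗[k] V) (D : Submodule k V) : Prop :=
  ∀ d ∈ D, δ d ∈ tens D D

/-- `D` is a simple subcoalgebra: nonzero, without proper nonzero subcoalgebras. -/
def IsSimpleSubcoalgebra (δ : V →ₗ[k] V ⊗[k] V) (D : Submodule k V) : Prop :=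
  IsSubcoalgebra δ D ∧ D ≠ ⊥ ∧ ∀ E ≤ D, IsSubcoalgebra δ E → E = ⊥ ∨ E = D

/-- The coradical: the sum of all simple subcoalgebras. -/
def coradical (δ : V →ₗ[k] V ⊗[k] V) : Submodule k V :=
  sSup {D | IsSimpleSubcoalgebra δ D}

/-- The coradical filtration: `C₀` is the coradical and
`Cₙ₊₁ = Δ⁻¹(C ⊗ Cₙ + C₀ ⊗ C)`. -/
def coradicalFiltration (δ : V →ₗ[k] V ⊗[k] V) : ℕ → Submodule k V
  | 0 => coradical δ
  | n + 1 => (tens ⊤ (coradicalFiltration δ n) ⊔ tens (coradical δ) ⊤).comap δ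

/-- A coalgebra is pointed if all its simple subcoalgebras (equivalently, all its simple
comodules) are one-dimensional. -/
def IsPointed (δ : V →ₗ[k] V ⊗[k] V) : Prop :=
  ∀ D, IsSimpleSubcoalgebra δ D → Module.finrank k D = 1

/-- Group-like elements: `Δ(a) = a ⊗ a` and `ε(a) = 1`. -/
def MajidData.IsGroupLike (A : MajidData k V) (a : V) : Prop :=
  A.comul a = a ⊗ₜ[k] a ∧ A.counit a = 1

/-- Skew-primitive elements: `Δ(X) = X ⊗ g + h ⊗ X` for some group-like `g`, `h`. -/
def MajidData.IsSkewPrimitive (A : MajidData k V) (X : V) : Prop :=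
  ∃ g h, A.IsGroupLike g ∧ A.IsGroupLike h ∧ A.comul X = X ⊗ₜ[k] g + h ⊗ₜ[k] X

end Majid

/-! ### The bosonization of a braided Hopf algebra in the Yetter-Drinfeld category -/

section Smash

set_option linter.unusedSectionVars false

variable {k : Type*} [Field k] {G : Type*} [CommGroup G] [Fintype G]
  {H : Type*} [AddCommGroup H] [Module k H]

/-- The underlying data of a braided Hopf algebra in the Yetter-Drinfeld category of `(kG, Φ)`:
the `G`-grading, given by the projections `comp x` onto the homogeneous components `H_x`,
the (projective) action `f ▷ X`, the product, unit, coproduct, counit and antipode. -/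
structure YDHopfData (k : Type*) [Field k] (G : Type*) (H : Type*) [AddCommGroup H]
    [Module k H] where
  comp : G → H →ₗ[k] H
  act : G → H →ₗ[k] H
  mul : H →ₗ[k] H →ₗ[k] H
  one : H
  comul : H →ₗ[k] H ⊗[k] H
  counit : H →ₗ[k] k
  antipode : H →ₗ[k] H

/-- The linear map `X ↦ X ⊗ g`. -/
noncomputable def tenG (g : G) : H →ₗ[k] H ⊗[k] MonoidAlgebra k G :=
  (TensorProduct.mk k H (MonoidAlgebra k G)).flip (MonoidAlgebra.single g 1)

/-- The coefficient of a group element `g`, as a functional on the group algebra. -/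
def coeffG (g : G) : MonoidAlgebra k G →ₗ[k] k where
  toFun u := u.coeff g
  map_add' _ _ := by simp
  map_smul' _ _ := by simp

/-- The coefficient of `g`: every `u` in `H ⊗ kG` is `∑ g, atG g u ⊗ g`. -/
noncomputable def atG (g : G) : H ⊗[k] MonoidAlgebra k G →ₗ[k] H :=
  (TensorProduct.rid k H).toLinearMap ∘ₗ (coeffG g).lTensor H

theorem atG_tmul [DecidableEq G] (g h : G) (X : H) :
    atG (k := k) g (X ⊗ₜ MonoidAlgebra.single h 1) = if h = g then X else 0 := by
  have : coeffG (k := k) g (MonoidAlgebra.single h 1) = if h = g then 1 else 0 := by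
    change (MonoidAlgebra.single h 1 : MonoidAlgebra k G).coeff g = _
    simp [Finsupp.single_apply]
  simp [atG, this]

/-- The product of `H # kG`: for `X`, `Y` homogeneous of degrees `x`, `y`,
`(X ⊗ g)(Y ⊗ h) = Φ(xg,y,h) Φ(x,y,g) / (Φ(x,g,y) Φ(xy,g,h)) X (g ▷ Y) ⊗ gh`. -/
noncomputable def smashMul (Φ : G → G → G → k) (R : YDHopfData k G H) :
    H ⊗[k] MonoidAlgebra k G →ₗ[k] H ⊗[k] MonoidAlgebra k G →ₗ[k] H ⊗[k] MonoidAlgebra k G :=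
  ∑ g, ∑ h, ∑ x, ∑ y, (Φ (x * g) y h * Φ x y g / (Φ x g y * Φ (x * y) g h)) •
    (R.mul.compl₁₂ (R.comp x ∘ₗ atG g) (R.act g ∘ₗ R.comp y ∘ₗ atG h)).compr₂ (tenG (g * h))

/-- The data of the Majid algebra `H # kG` on `H ⊗ kG`.  With `Δ_H(X) = X₁ ⊗ X₂` and
`X₁`, `X₂` homogeneous of degrees `x₁`, `x₂`,
* `Δ(X ⊗ g) = Φ(x₁,x₂,g)⁻¹ (X₁ ⊗ x₂g) ⊗ (X₂ ⊗ g)`, `ε(X ⊗ g) = ε_H(X)`;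
* the associator is `Φ` on `G`, extended by zero: on `X ⊗ g`, `Y ⊗ h`, `Z ⊗ e` it is
  `ε_H(X) ε_H(Y) ε_H(Z) Φ(g,h,e)`;
* for `X` homogeneous of degree `x`, `S(X ⊗ g)` is
  `Φ(g⁻¹,g,g⁻¹) / (Φ(x⁻¹g⁻¹,xg,g⁻¹) Φ(x,g,g⁻¹)) (1 ⊗ x⁻¹g⁻¹)(S_H(X) ⊗ 1)`;
* `α(X ⊗ g) = ε_H(X)`, `β(X ⊗ g) = ε_H(X) Φ(g,g⁻¹,g)⁻¹`.
Here `H` is an `ℕ`-graded connected braided Hopf algebra, so `ε_H` is `1` at the unit and vanishes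
in positive length. -/
noncomputable def smash (Φ : G → G → G → k) (R : YDHopfData k G H) :
    MajidData k (H ⊗[k] MonoidAlgebra k G) where
  comul := ∑ g, ∑ x₁, ∑ x₂, (Φ x₁ x₂ g)⁻¹ •
    (TensorProduct.map (tenG (x₂ * g) ∘ₗ R.comp x₁) (tenG g ∘ₗ R.comp x₂) ∘ₗ R.comul ∘ₗ atG g)
  counit := ∑ g, R.counit ∘ₗ atG g
  mul := smashMul Φ R
  one := R.one ⊗ₜ MonoidAlgebra.single 1 1
  assoc := ∑ g, ∑ h, ∑ e, Φ g h e • (R.counit ∘ₗ atG g).smulRight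
    ((R.counit ∘ₗ atG h).smulRight (R.counit ∘ₗ atG e))
  antipode := ∑ g, ∑ x, (Φ g⁻¹ g g⁻¹ / (Φ (x⁻¹ * g⁻¹) (x * g) g⁻¹ * Φ x g g⁻¹)) •
    (smashMul Φ R (R.one ⊗ₜ MonoidAlgebra.single (x⁻¹ * g⁻¹) 1) ∘ₗ tenG 1 ∘ₗ R.antipode ∘ₗ
      R.comp x ∘ₗ atG g)
  alpha := ∑ g, R.counit ∘ₗ atG g
  beta := ∑ g, (Φ g g⁻¹ g)⁻¹ • (R.counit ∘ₗ atG g)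

end Smash

/-! ### Graded pointed Majid algebras and their coinvariants -/

section Coinvariants

set_option linter.unusedSectionVars false

variable {k : Type*} [Field k] {G : Type*} [CommGroup G] [Fintype G]
  {M : Type*} [AddCommGroup M] [Module k M]

/-- `A` is a Majid algebra on `M` which is graded (coradically graded as a coalgebra, all structure
maps respecting the grading), pointed, with group of group-like elements identified
with the abelian group `G` through `ι`, with quasi-antipode normalized by `α(g) = 1` on `G`, and
generated by `G` and a set of skew-primitive elements. -/
structure IsGradedPointedMajid (A : MajidData k M) (𝓜 : ℕ → Submodule k M) (ι : G → M) :
    Prop where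
  isMajid : A.IsMajidAlgebra
  comul_mem : ∀ n, ∀ a ∈ 𝓜 n,
    A.comul a ∈ ⨆ p : {p : ℕ × ℕ // p.1 + p.2 = n}, tens (𝓜 p.1.1) (𝓜 p.1.2)
  counit_eq_zero : ∀ n, n ≠ 0 → ∀ a ∈ 𝓜 n, A.counit a = 0
  one_mem : A.one ∈ 𝓜 0
  mul_mem : ∀ i j, ∀ a ∈ 𝓜 i, ∀ b ∈ 𝓜 j, A.mul a b ∈ 𝓜 (i + j)
  assoc_eq_zero : ∀ i j l, i + j + l ≠ 0 → ∀ a ∈ 𝓜 i, ∀ b ∈ 𝓜 j, ∀ c ∈ 𝓜 l, A.assoc a b c = 0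
  antipode_mem : ∀ n, ∀ a ∈ 𝓜 n, A.antipode a ∈ 𝓜 n
  alpha_eq_zero : ∀ n, n ≠ 0 → ∀ a ∈ 𝓜 n, A.alpha a = 0
  beta_eq_zero : ∀ n, n ≠ 0 → ∀ a ∈ 𝓜 n, A.beta a = 0
  /-- the grading is the coradical one: `Mₙ = M(0) ⊕ ⋯ ⊕ M(n)` -/
  coradicalFiltration_eq : ∀ n, coradicalFiltration A.comul n = ⨆ i : Fin (n + 1), 𝓜 i
  isPointed : IsPointed A.comul
  /-- `ι` identifies `G` with the group of all group-like elements -/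
  ι_injective : Function.Injective ι
  range_ι : Set.range ι = {a | A.IsGroupLike a}
  ι_one : ι 1 = A.one
  ι_mul : ∀ g h, ι (g * h) = A.mul (ι g) (ι h)
  alpha_ι : ∀ g, A.alpha (ι g) = 1
  /-- `M` is generated by `G` and a set of skew-primitive elements -/
  generated : ∃ 𝒳 : Set M, (∀ X ∈ 𝒳, A.IsSkewPrimitive X) ∧
    ∀ N : Submodule k M, (∀ g, ι g ∈ N) → (∀ X ∈ 𝒳, X ∈ N) →
      (∀ a ∈ N, ∀ b ∈ N, A.mul a b ∈ N) → N = ⊤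

/-- The restriction of the associator to the group-like elements: a normalized `3`-cocycle. -/
def groupAssoc (A : MajidData k M) (ι : G → M) (f g h : G) : k :=
  A.assoc (ι f) (ι g) (ι h)

section Proj

variable (𝓜 : ℕ → Submodule k M) [DirectSum.Decomposition 𝓜]

/-- The projection `M → M(0)` along the grading. -/
def proj₀ : M →ₗ[k] 𝓜 0 :=
  DirectSum.component k ℕ (fun i => 𝓜 i) 0 ∘ₗ (DirectSum.decomposeLinearEquiv 𝓜).toLinearMap

/-- The canonical projection `π : M → M₀`, as an endomorphism of `M`. -/
def proj : M →ₗ[k] M := (𝓜 0).subtype ∘ₗ proj₀ 𝓜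

theorem proj₀_coe (m : 𝓜 0) : proj₀ 𝓜 m = m :=
  Subtype.ext (DirectSum.decompose_of_mem_same 𝓜 m.2)

theorem proj₀_of_ne {n : ℕ} (hn : n ≠ 0) {m : M} (hm : m ∈ 𝓜 n) : proj₀ 𝓜 m = 0 :=
  Subtype.ext (DirectSum.decompose_of_mem_ne 𝓜 hm hn)

theorem hom_induction {p : M → Prop} (h0 : ∀ m ∈ 𝓜 0, p m) (h1 : ∀ n ≠ 0, ∀ m ∈ 𝓜 n, p m)
    (hadd : ∀ a b, p a → p b → p (a + b)) (m : M) : p m := by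
  refine DirectSum.Decomposition.inductionOn 𝓜 (h0 0 (zero_mem _)) (fun {i} m => ?_) hadd m
  rcases eq_or_ne i 0 with rfl | hi
  exacts [h0 _ m.2, h1 i hi _ m.2]

/-- The coinvariants `R = {x | (id ⊗ π) Δ(x) = x ⊗ 1}`. -/
def coinv (A : MajidData k M) : Submodule k M :=
  LinearMap.eqLocus ((proj 𝓜).lTensor M ∘ₗ A.comul) ((TensorProduct.mk k M M).flip A.one)

theorem mem_coinv {A : MajidData k M} {x : M} :
    x ∈ coinv 𝓜 A ↔ (proj 𝓜).lTensor M (A.comul x) = x ⊗ₜ A.one := Iff.rfl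

end Proj

theorem apply_eq_zero_of_mem_tens {φ ψ : M →ₗ[k] k} {P Q : Submodule k M}
    (h : (∀ a ∈ P, φ a = 0) ∨ ∀ b ∈ Q, ψ b = 0) :
    tens P Q ≤ LinearMap.ker (LinearMap.mul' k k ∘ₗ TensorProduct.map φ ψ) := by
  refine Submodule.map₂_le.2 fun a ha b hb => ?_
  rcases h with h | h <;> simp [h _ ‹_›]

theorem tens_span_singleton (d : M) :
    tens (Submodule.span k {d}) (Submodule.span k {d}) = Submodule.span k {d ⊗ₜ[k] d} := by
  rw [tens, Submodule.map₂_span_span]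
  simp

/-- In a pointed coalgebra the coradical is spanned by the group-like elements. -/
theorem coradical_le_span {A : MajidData k M} (hA : A.IsMajidAlgebra) (hp : IsPointed A.comul) :
    coradical A.comul ≤ Submodule.span k {a | A.IsGroupLike a} := by
  refine sSup_le fun D hD => ?_
  obtain ⟨⟨d, hdD⟩, hd', hs⟩ := finrank_eq_one_iff'.1 (hp D hD)
  have hd : d ≠ 0 := fun h => hd' (Subtype.ext h)
  obtain rfl : D = Submodule.span k {d} := by
    refine le_antisymm (fun x hx => ?_) (by simpa using hdD)
    obtain ⟨c, hc⟩ := hs ⟨x, hx⟩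
    exact Submodule.mem_span_singleton.2 ⟨c, congrArg Subtype.val hc⟩
  have h1 := hD.1 d (Submodule.mem_span_singleton_self d)
  rw [tens_span_singleton, Submodule.mem_span_singleton] at h1
  obtain ⟨c, hc⟩ := h1
  have h2 := hA.counit_left d
  rw [← hc] at h2
  simp only [map_smul, LinearMap.rTensor_tmul, TensorProduct.lid_tmul, smul_smul] at h2
  have h3 : c * A.counit d = 1 := by
    by_contra h
    have : (c * A.counit d - 1) • d = 0 := by rw [sub_smul, h2, one_smul, sub_self]
    rcases smul_eq_zero.1 this with h' | h'
    exacts [h (sub_eq_zero.1 h'), hd h']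
  have hc0 : c ≠ 0 := left_ne_zero_of_mul_eq_one h3
  have h4 : A.IsGroupLike (c • d) := by
    refine ⟨?_, by simpa using h3⟩
    rw [map_smul, ← hc, TensorProduct.smul_tmul_smul, smul_smul]
  rw [Submodule.span_singleton_le_iff_mem]
  have := Submodule.smul_mem _ c⁻¹ (Submodule.subset_span (R := k) (s := {a | A.IsGroupLike a}) h4)
  rwa [smul_smul, inv_mul_cancel₀ hc0, one_smul] at this

theorem isGroupLike_mem_coradical {A : MajidData k M} {a : M} (ha : A.IsGroupLike a) :
    a ∈ coradical A.comul := by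
  have ha0 : a ≠ 0 := by rintro rfl; simpa using ha.2
  refine (le_sSup (α := Submodule k M) (a := Submodule.span k {a}) ?_)
    (Submodule.mem_span_singleton_self a)
  refine ⟨?_, by simpa using ha0, fun E hE _ => ?_⟩
  · intro d hd
    obtain ⟨c, rfl⟩ := Submodule.mem_span_singleton.1 hd
    rw [tens_span_singleton, map_smul, ha.1]
    exact Submodule.smul_mem _ _ (Submodule.mem_span_singleton_self _)
  · have := (nonzero_span_atom a ha0).le_iff.1 hE
    simpa using this

namespace IsGradedPointedMajid

variable {A : MajidData k M} {𝓜 : ℕ → Submodule k M} {ι : G → M}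

theorem isGroupLike (hM : IsGradedPointedMajid A 𝓜 ι) (g : G) : A.IsGroupLike (ι g) :=
  hM.range_ι.subset ⟨g, rfl⟩

theorem span_eq (hM : IsGradedPointedMajid A 𝓜 ι) :
    Submodule.span k (Set.range ι) = 𝓜 0 := by
  have h0 : coradical A.comul = 𝓜 0 := by
    simpa [coradicalFiltration] using hM.coradicalFiltration_eq 0
  refine le_antisymm (Submodule.span_le.2 ?_) ?_
  · rintro _ ⟨g, rfl⟩
    rw [← h0]
    exact isGroupLike_mem_coradical (hM.isGroupLike g)
  · rw [← h0, hM.range_ι]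
    exact coradical_le_span hM.isMajid hM.isPointed

theorem ι_mem (hM : IsGradedPointedMajid A 𝓜 ι) (g : G) : ι g ∈ 𝓜 0 :=
  hM.span_eq ▸ Submodule.subset_span ⟨g, rfl⟩

theorem linearIndependent_ι (hM : IsGradedPointedMajid A 𝓜 ι) : LinearIndependent k ι := by
  let _ : Coalgebra k M :=
    { comul := A.comul
      counit := A.counit
      coassoc := hM.isMajid.coassoc
      rTensor_counit_comp_comul := by
        ext m
        have := hM.isMajid.counit_left m
        rw [← LinearEquiv.eq_symm_apply] at this
        simpa using this
      lTensor_counit_comp_comul := by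
        ext m
        have := hM.isMajid.counit_right m
        rw [← LinearEquiv.eq_symm_apply] at this
        simpa using this }
  let j : G → GroupLike k M := fun g => ⟨ι g, (hM.isGroupLike g).2, (hM.isGroupLike g).1⟩
  have hj : Function.Injective j := fun a b h => hM.ι_injective (congrArg GroupLike.val h)
  exact (linearIndep_groupLikeVal (R := k) (A := M)).comp j hj

/-- The basis `G` of `M(0) = kG`. -/
noncomputable def basis₀ (hM : IsGradedPointedMajid A 𝓜 ι) : Module.Basis G k (𝓜 0) :=
  Module.Basis.mk (v := fun g => (⟨ι g, hM.ι_mem g⟩ : 𝓜 0))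
    (LinearIndependent.of_comp (𝓜 0).subtype hM.linearIndependent_ι) (by
      rintro ⟨x, hx⟩ -
      rw [← Submodule.apply_mem_span_image_iff_mem_span (Submodule.subtype_injective (𝓜 0)),
        ← Set.range_comp]
      change x ∈ Submodule.span k (Set.range ι)
      rwa [hM.span_eq])

variable [DirectSum.Decomposition 𝓜]

/-- The coefficient of `g` in `π(m)`. -/
noncomputable def coeff (hM : IsGradedPointedMajid A 𝓜 ι) (g : G) : M →ₗ[k] k :=
  hM.basis₀.coord g ∘ₗ proj₀ 𝓜

/-- `m ↦ ⟨g, π(m₁)⟩ m₂`, the projection of `M` onto `{m | (π ⊗ id) Δ(m) = g ⊗ m}`, that is, onto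
the component of degree `g` for the left `kG`-coaction. -/
noncomputable def leftComp (hM : IsGradedPointedMajid A 𝓜 ι) (g : G) : M →ₗ[k] M :=
  (TensorProduct.lid k M).toLinearMap ∘ₗ (hM.coeff g).rTensor M ∘ₗ A.comul

/-- `m ↦ m₁ ⟨g, π(m₂)⟩`, the projection of `M` onto `{m | (id ⊗ π) Δ(m) = m ⊗ g}`. -/
noncomputable def rightComp (hM : IsGradedPointedMajid A 𝓜 ι) (g : G) : M →ₗ[k] M :=
  (TensorProduct.rid k M).toLinearMap ∘ₗ (hM.coeff g).lTensor M ∘ₗ A.comul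

theorem coeff_ι [DecidableEq G] (hM : IsGradedPointedMajid A 𝓜 ι) (g h : G) :
    hM.coeff g (ι h) = if g = h then 1 else 0 := by
  have : proj₀ 𝓜 (ι h) = hM.basis₀ h := by
    rw [basis₀, Module.Basis.mk_apply]
    exact proj₀_coe 𝓜 ⟨ι h, hM.ι_mem h⟩
  rw [coeff, LinearMap.comp_apply, this]
  simp [Finsupp.single_apply, eq_comm]

theorem coeff_of_ne (hM : IsGradedPointedMajid A 𝓜 ι) (g : G) {n : ℕ} (hn : n ≠ 0) {m : M}
    (hm : m ∈ 𝓜 n) : hM.coeff g m = 0 := by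
  simp [coeff, proj₀_of_ne 𝓜 hn hm]

theorem proj_eq (hM : IsGradedPointedMajid A 𝓜 ι) (m : M) :
    proj 𝓜 m = ∑ g, hM.coeff g m • ι g := by
  have h := congrArg (𝓜 0).subtype (hM.basis₀.sum_repr (proj₀ 𝓜 m))
  rw [map_sum] at h
  rw [proj, LinearMap.comp_apply, ← h]
  refine Finset.sum_congr rfl fun g _ => ?_
  rw [map_smul, basis₀, Module.Basis.mk_apply]
  rfl

theorem lin_ext (hM : IsGradedPointedMajid A 𝓜 ι) {W : Type*} [AddCommGroup W] [Module k W]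
    {φ ψ : M →ₗ[k] W} (hι : ∀ g, φ (ι g) = ψ (ι g))
    (h1 : ∀ n ≠ 0, ∀ m ∈ 𝓜 n, φ m = ψ m) : φ = ψ := by
  ext m
  refine hom_induction 𝓜 (p := fun m => φ m = ψ m) (fun m hm => ?_) h1
    (fun a b ha hb => by simp only [map_add, ha, hb]) m
  rw [← hM.span_eq] at hm
  exact LinearMap.eqOn_span (by rintro _ ⟨g, rfl⟩; exact hι g) hm

theorem coeff_comul [DecidableEq G] (hM : IsGradedPointedMajid A 𝓜 ι) (g h : G) :
    LinearMap.mul' k k ∘ₗ TensorProduct.map (hM.coeff g) (hM.coeff h) ∘ₗ A.comul =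
      if g = h then hM.coeff g else 0 := by
  refine hM.lin_ext ?_ ?_
  · intro f
    simp only [LinearMap.comp_apply]
    rw [(hM.isGroupLike f).1]
    simp only [TensorProduct.map_tmul, LinearMap.mul'_apply, coeff_ι]
    split_ifs <;> simp_all [coeff_ι]
  · intro n hn m hm
    have h1 := hM.comul_mem n m hm
    have h2 : (⨆ p : {p : ℕ × ℕ // p.1 + p.2 = n}, tens (𝓜 p.1.1) (𝓜 p.1.2)) ≤
        LinearMap.ker (LinearMap.mul' k k ∘ₗ TensorProduct.map (hM.coeff g) (hM.coeff h)) := by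
      refine iSup_le fun ⟨⟨i, j⟩, hij⟩ => apply_eq_zero_of_mem_tens ?_
      dsimp only at hij ⊢
      rcases eq_or_ne i 0 with rfl | hi
      · exact Or.inr fun b hb => hM.coeff_of_ne h (by omega) hb
      · exact Or.inl fun b hb => hM.coeff_of_ne g hi hb
    have h3 := h2 h1
    simp only [LinearMap.mem_ker, LinearMap.comp_apply] at h3 ⊢
    rw [h3]
    split_ifs <;> simp [hM.coeff_of_ne _ hn hm]

theorem coeff_mul (hM : IsGradedPointedMajid A 𝓜 ι) (g : G) (a b : M) :
    hM.coeff g (A.mul a b) = ∑ f, hM.coeff f a * hM.coeff (f⁻¹ * g) b := by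
  classical
  suffices h : A.mul.compr₂ (hM.coeff g) =
      ∑ f, (hM.coeff f).smulRight (hM.coeff (f⁻¹ * g)) by
    simpa [LinearMap.sum_apply] using LinearMap.congr_fun₂ h a b
  refine hM.lin_ext (fun h => hM.lin_ext (fun h' => ?_) fun n hn m hm => ?_) fun n hn m hm => ?_
  · simp only [LinearMap.compr₂_apply, LinearMap.sum_apply, LinearMap.smulRight_apply,
      LinearMap.smul_apply, smul_eq_mul]
    rw [← hM.ι_mul]
    simp only [coeff_ι, ite_mul, one_mul, zero_mul, Finset.sum_ite_eq', Finset.mem_univ, if_true,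
      inv_mul_eq_iff_eq_mul]
  · have := hM.coeff_of_ne g (n := 0 + n) (by omega) (hM.mul_mem 0 n _ (hM.ι_mem h) _ hm)
    simp [LinearMap.sum_apply, hM.coeff_of_ne _ hn hm, this]
  · ext b
    have h2 : hM.coeff g ∘ₗ A.mul m = 0 := by
      refine hM.lin_ext (fun h => ?_) fun i hi b hb => ?_
      · exact hM.coeff_of_ne g (n := n + 0) (by omega) (hM.mul_mem n 0 _ hm _ (hM.ι_mem h))
      · exact hM.coeff_of_ne g (n := n + i) (by omega) (hM.mul_mem n i _ hm _ hb)
    simpa [LinearMap.sum_apply, hM.coeff_of_ne _ hn hm] using LinearMap.congr_fun h2 b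

theorem antipode_ι (hM : IsGradedPointedMajid A 𝓜 ι) (g : G) : A.antipode (ι g) = ι g⁻¹ := by
  have h1 : A.IsGroupLike (A.antipode (ι g)) := by
    refine ⟨?_, ?_⟩
    · rw [hM.isMajid.comul_antipode, (hM.isGroupLike g).1]; simp
    · rw [hM.isMajid.counit_antipode, (hM.isGroupLike g).2]
  obtain ⟨h, hh⟩ := hM.range_ι.superset h1
  have h2 := hM.isMajid.antipode_alpha (ι g)
    ⟨1, fun _ => ι g, fun _ => ι g, fun _ => ι g, by simp [(hM.isGroupLike g).1]⟩
  simp only [Finset.univ_unique, Finset.sum_singleton, hM.alpha_ι, one_smul, ← hh,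
    ← hM.ι_mul, ← hM.ι_one] at h2
  rw [← hh, eq_inv_of_mul_eq_one_left (hM.ι_injective h2)]

theorem coeff_antipode (hM : IsGradedPointedMajid A 𝓜 ι) (g : G) (a : M) :
    hM.coeff g (A.antipode a) = hM.coeff g⁻¹ a := by
  classical
  suffices h : hM.coeff g ∘ₗ A.antipode = hM.coeff g⁻¹ from LinearMap.congr_fun h a
  refine hM.lin_ext (fun h => ?_) fun n hn m hm => ?_
  · simp only [LinearMap.comp_apply, hM.antipode_ι, coeff_ι, inv_eq_iff_eq_inv]
  · rw [LinearMap.comp_apply, hM.coeff_of_ne _ hn hm, hM.coeff_of_ne _ hn (hM.antipode_mem n _ hm)]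

theorem comul_leftComp (hM : IsGradedPointedMajid A 𝓜 ι) (g : G) (m : M) :
    A.comul (hM.leftComp g m) = (hM.leftComp g).rTensor M (A.comul m) := by
  have h := LinearMap.congr_fun hM.isMajid.coassoc m
  simp only [LinearMap.comp_apply, LinearEquiv.coe_coe] at h
  have h1 : ∀ t : M ⊗[k] M, A.comul (TensorProduct.lid k M ((hM.coeff g).rTensor M t)) =
      TensorProduct.lid k (M ⊗[k] M) ((hM.coeff g).rTensor _ (A.comul.lTensor M t)) := by
    intro t
    induction t with
    | zero => simp
    | tmul a b => simp
    | add a b ha hb => simp only [map_add, ha, hb]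
  have h2 : ∀ t : M ⊗[k] M, (hM.leftComp g).rTensor M t =
      TensorProduct.lid k (M ⊗[k] M) ((hM.coeff g).rTensor _
        (TensorProduct.assoc k M M M (A.comul.rTensor M t))) := by
    intro t
    induction t with
    | zero => simp
    | tmul a b =>
      simp only [LinearMap.rTensor_tmul, leftComp, LinearMap.comp_apply, LinearEquiv.coe_coe]
      induction A.comul a with
      | zero => simp
      | tmul p q => simp [TensorProduct.smul_tmul']
      | add p q hp hq => simp only [map_add, TensorProduct.add_tmul, hp, hq]
    | add a b ha hb => simp only [map_add, ha, hb]
  rw [h2, h, ← h1]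
  rfl

theorem comul_rightComp (hM : IsGradedPointedMajid A 𝓜 ι) (g : G) (m : M) :
    A.comul (hM.rightComp g m) = (hM.rightComp g).lTensor M (A.comul m) := by
  have h := LinearMap.congr_fun hM.isMajid.coassoc m
  simp only [LinearMap.comp_apply, LinearEquiv.coe_coe] at h
  rw [← LinearEquiv.eq_symm_apply] at h
  have h1 : ∀ t : M ⊗[k] M, A.comul (TensorProduct.rid k M ((hM.coeff g).lTensor M t)) =
      TensorProduct.rid k (M ⊗[k] M) ((hM.coeff g).lTensor _ (A.comul.rTensor M t)) := by
    intro t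
    induction t with
    | zero => simp
    | tmul a b => simp
    | add a b ha hb => simp only [map_add, ha, hb]
  have h2 : ∀ t : M ⊗[k] M, (hM.rightComp g).lTensor M t =
      TensorProduct.rid k (M ⊗[k] M) ((hM.coeff g).lTensor _
        ((TensorProduct.assoc k M M M).symm (A.comul.lTensor M t))) := by
    intro t
    induction t with
    | zero => simp
    | tmul a b =>
      simp only [LinearMap.lTensor_tmul, rightComp, LinearMap.comp_apply, LinearEquiv.coe_coe]
      induction A.comul b with
      | zero => simp
      | tmul p q => simp
      | add p q hp hq => simp only [map_add, TensorProduct.tmul_add, hp, hq]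
    | add a b ha hb => simp only [map_add, ha, hb]
  rw [h2, ← h, ← h1]
  rfl

theorem rTensor_rightComp (hM : IsGradedPointedMajid A 𝓜 ι) (g : G) (m : M) :
    (hM.rightComp g).rTensor M (A.comul m) = (hM.leftComp g).lTensor M (A.comul m) := by
  have h := LinearMap.congr_fun hM.isMajid.coassoc m
  simp only [LinearMap.comp_apply, LinearEquiv.coe_coe] at h
  have h1 : ∀ t : M ⊗[k] M, (hM.leftComp g).lTensor M t =
      ((TensorProduct.lid k M).toLinearMap ∘ₗ (hM.coeff g).rTensor M).lTensor M
        (A.comul.lTensor M t) := by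
    intro t
    rw [← LinearMap.lTensor_comp_apply]
    rfl
  have h2 : ∀ t : M ⊗[k] M, (hM.rightComp g).rTensor M t =
      ((TensorProduct.lid k M).toLinearMap ∘ₗ (hM.coeff g).rTensor M).lTensor M
        (TensorProduct.assoc k M M M (A.comul.rTensor M t)) := by
    intro t
    induction t with
    | zero => simp
    | tmul a b =>
      simp only [LinearMap.rTensor_tmul, rightComp, LinearMap.comp_apply, LinearEquiv.coe_coe]
      induction A.comul a with
      | zero => simp
      | tmul p q => simp [TensorProduct.smul_tmul]
      | add p q hp hq => simp only [map_add, TensorProduct.add_tmul, hp, hq]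
    | add a b ha hb => simp only [map_add, ha, hb]
  rw [h2, h, ← h1]

theorem coeff_leftComp [DecidableEq G] (hM : IsGradedPointedMajid A 𝓜 ι) (g h : G) (m : M) :
    hM.coeff g (hM.leftComp h m) = if h = g then hM.coeff h m else 0 := by
  have h1 := LinearMap.congr_fun (hM.coeff_comul h g) m
  have h2 : ∀ t : M ⊗[k] M, hM.coeff g (TensorProduct.lid k M ((hM.coeff h).rTensor M t)) =
      LinearMap.mul' k k (TensorProduct.map (hM.coeff h) (hM.coeff g) t) := by
    intro t
    induction t with
    | zero => simp
    | tmul a b => simp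
    | add a b ha hb => simp only [map_add, ha, hb]
  refine (h2 _).trans (h1.trans ?_)
  split_ifs <;> rfl

theorem coeff_rightComp [DecidableEq G] (hM : IsGradedPointedMajid A 𝓜 ι) (g h : G) (m : M) :
    hM.coeff g (hM.rightComp h m) = if g = h then hM.coeff g m else 0 := by
  have h1 := LinearMap.congr_fun (hM.coeff_comul g h) m
  have h2 : ∀ t : M ⊗[k] M, hM.coeff g (TensorProduct.rid k M ((hM.coeff h).lTensor M t)) =
      LinearMap.mul' k k (TensorProduct.map (hM.coeff g) (hM.coeff h) t) := by
    intro t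
    induction t with
    | zero => simp
    | tmul a b => simp [mul_comm]
    | add a b ha hb => simp only [map_add, ha, hb]
  refine (h2 _).trans (h1.trans ?_)
  split_ifs <;> rfl

theorem leftComp_leftComp [DecidableEq G] (hM : IsGradedPointedMajid A 𝓜 ι) (g h : G) (m : M) :
    hM.leftComp g (hM.leftComp h m) = if h = g then hM.leftComp h m else 0 := by
  change TensorProduct.lid k M ((hM.coeff g).rTensor M (A.comul (hM.leftComp h m))) = _
  rw [comul_leftComp,
    ← LinearMap.rTensor_comp_apply]
  have : hM.coeff g ∘ₗ hM.leftComp h = if h = g then hM.coeff h else 0 := by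
    ext x
    rw [LinearMap.comp_apply, coeff_leftComp]
    split_ifs <;> rfl
  rw [this]
  split_ifs
  · rfl
  · simp

theorem rightComp_rightComp [DecidableEq G] (hM : IsGradedPointedMajid A 𝓜 ι) (g h : G) (m : M) :
    hM.rightComp g (hM.rightComp h m) = if g = h then hM.rightComp g m else 0 := by
  change TensorProduct.rid k M ((hM.coeff g).lTensor M (A.comul (hM.rightComp h m))) = _
  rw [comul_rightComp,
    ← LinearMap.lTensor_comp_apply]
  have : hM.coeff g ∘ₗ hM.rightComp h = if g = h then hM.coeff g else 0 := by
    ext x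
    rw [LinearMap.comp_apply, coeff_rightComp]
    split_ifs <;> rfl
  rw [this]
  split_ifs
  · rfl
  · simp

theorem rightComp_leftComp (hM : IsGradedPointedMajid A 𝓜 ι) (g h : G) (m : M) :
    hM.rightComp g (hM.leftComp h m) = hM.leftComp h (hM.rightComp g m) := by
  have h1 : ∀ t : M ⊗[k] M,
      TensorProduct.rid k M ((hM.coeff g).lTensor M ((hM.leftComp h).rTensor M t)) =
        hM.leftComp h (TensorProduct.rid k M ((hM.coeff g).lTensor M t)) := by
    intro t
    induction t with
    | zero => simp
    | tmul a b => simp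
    | add a b ha hb => simp only [map_add, ha, hb]
  have h2 := h1 (A.comul m)
  rw [← comul_leftComp] at h2
  exact h2

theorem rightComp_mul (hM : IsGradedPointedMajid A 𝓜 ι) (g : G) (a b : M) :
    hM.rightComp g (A.mul a b) =
      ∑ f, A.mul (hM.rightComp f a) (hM.rightComp (f⁻¹ * g) b) := by
  obtain ⟨s⟩ := Sweedler2.nonempty A.comul a
  obtain ⟨t⟩ := Sweedler2.nonempty A.comul b
  simp only [rightComp, LinearMap.comp_apply, LinearEquiv.coe_coe,
    hM.isMajid.comul_mul a b s t, s.eq, t.eq, map_sum, LinearMap.lTensor_tmul,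
    TensorProduct.rid_tmul, LinearMap.sum_apply, map_smul, LinearMap.smul_apply, coeff_mul,
    Finset.sum_smul]
  simp only [Finset.smul_sum, smul_smul]
  calc _ = ∑ i, ∑ f, ∑ j, (hM.coeff f (s.x₂ i) * hM.coeff (f⁻¹ * g) (t.x₂ j)) •
        A.mul (s.x₁ i) (t.x₁ j) := Finset.sum_congr rfl fun _ _ => Finset.sum_comm
    _ = ∑ f, ∑ i, ∑ j, (hM.coeff f (s.x₂ i) * hM.coeff (f⁻¹ * g) (t.x₂ j)) •
        A.mul (s.x₁ i) (t.x₁ j) := Finset.sum_comm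
    _ = _ := Finset.sum_congr rfl fun _ _ => by
      rw [Finset.sum_comm]
      exact Finset.sum_congr rfl fun _ _ => Finset.sum_congr rfl fun _ _ => by rw [mul_comm]

theorem rightComp_antipode (hM : IsGradedPointedMajid A 𝓜 ι) (g : G) (a : M) :
    hM.rightComp g (A.antipode a) = A.antipode (hM.leftComp g⁻¹ a) := by
  have h1 : ∀ t : M ⊗[k] M, TensorProduct.rid k M ((hM.coeff g).lTensor M
      (TensorProduct.comm k M M (TensorProduct.map A.antipode A.antipode t))) =
      A.antipode (TensorProduct.lid k M ((hM.coeff g⁻¹).rTensor M t)) := by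
    intro t
    induction t with
    | zero => simp
    | tmul a b => simp [coeff_antipode]
    | add a b ha hb => simp only [map_add, ha, hb]
  have h2 := h1 (A.comul a)
  rw [← hM.isMajid.comul_antipode] at h2
  exact h2

theorem rightComp_ι [DecidableEq G] (hM : IsGradedPointedMajid A 𝓜 ι) (g h : G) :
    hM.rightComp g (ι h) = if g = h then ι h else 0 := by
  simp [rightComp, (hM.isGroupLike h).1, coeff_ι]

theorem lTensor_proj (hM : IsGradedPointedMajid A 𝓜 ι) (x : M) :
    (proj 𝓜).lTensor M (A.comul x) = ∑ g, hM.rightComp g x ⊗ₜ ι g := by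
  simp only [rightComp, LinearMap.comp_apply, LinearEquiv.coe_coe]
  induction A.comul x with
  | zero => simp
  | tmul a b =>
    simp only [LinearMap.lTensor_tmul, hM.proj_eq, TensorProduct.tmul_sum, TensorProduct.rid_tmul,
      TensorProduct.smul_tmul]
  | add a b ha hb => simp only [map_add, ha, hb, TensorProduct.add_tmul, Finset.sum_add_distrib]

theorem mem_coinv_iff [DecidableEq G] (hM : IsGradedPointedMajid A 𝓜 ι) {x : M} :
    x ∈ coinv 𝓜 A ↔ ∀ g, hM.rightComp g x = if g = 1 then x else 0 := by
  rw [mem_coinv, hM.lTensor_proj]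
  refine ⟨fun h g => ?_, fun h => ?_⟩
  · have := congrArg (TensorProduct.rid k M ∘ (hM.coeff g).lTensor M) h
    simpa [← hM.ι_one, coeff_ι] using this
  · simp [h, TensorProduct.ite_tmul, ← hM.ι_one]

/-- Right degrees are multiplicative. -/
theorem rightComp_mul_of [DecidableEq G] (hM : IsGradedPointedMajid A 𝓜 ι) {a b : M} {x y : G}
    (ha : ∀ g, hM.rightComp g a = if g = x then a else 0)
    (hb : ∀ g, hM.rightComp g b = if g = y then b else 0) (g : G) :
    hM.rightComp g (A.mul a b) = if g = x * y then A.mul a b else 0 := by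
  rw [rightComp_mul, Finset.sum_eq_single x]
  · simp [ha, hb, inv_mul_eq_iff_eq_mul]
    split_ifs <;> simp
  · intro f _ hf
    simp [ha, hf]
  · simp

/-- The projection of `M` onto the coinvariants `R`: they form the component of degree `1` for the
right `kG`-coaction. -/
noncomputable def toCoinv (hM : IsGradedPointedMajid A 𝓜 ι) : M →ₗ[k] coinv 𝓜 A :=
  (hM.rightComp 1).codRestrict _ fun m => by
    classical
    rw [hM.mem_coinv_iff]
    intro g
    rw [rightComp_rightComp]
    split_ifs with h <;> simp [h]

theorem coe_toCoinv (hM : IsGradedPointedMajid A 𝓜 ι) {m : M} (hm : m ∈ coinv 𝓜 A) :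
    (hM.toCoinv m : M) = m := by
  classical
  exact (hM.mem_coinv_iff.1 hm 1).trans (if_pos rfl)

theorem one_mem_coinv (hM : IsGradedPointedMajid A 𝓜 ι) : A.one ∈ coinv 𝓜 A := by
  classical
  rw [hM.mem_coinv_iff, ← hM.ι_one]
  exact fun g => hM.rightComp_ι g 1

theorem leftComp_mem_coinv (hM : IsGradedPointedMajid A 𝓜 ι) (g : G) {X : M}
    (hX : X ∈ coinv 𝓜 A) : hM.leftComp g X ∈ coinv 𝓜 A := by
  classical
  rw [hM.mem_coinv_iff] at hX ⊢
  intro h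
  rw [rightComp_leftComp, hX]
  split_ifs <;> simp

theorem mul_mem_coinv (hM : IsGradedPointedMajid A 𝓜 ι) {X Y : M}
    (hX : X ∈ coinv 𝓜 A) (hY : Y ∈ coinv 𝓜 A) : A.mul X Y ∈ coinv 𝓜 A := by
  classical
  rw [hM.mem_coinv_iff] at hX hY ⊢
  intro h
  rw [hM.rightComp_mul_of hX hY, mul_one]

theorem conj_mem_coinv (hM : IsGradedPointedMajid A 𝓜 ι) (f : G) {X : M}
    (hX : X ∈ coinv 𝓜 A) : A.mul (A.mul (ι f) X) (ι f⁻¹) ∈ coinv 𝓜 A := by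
  classical
  rw [hM.mem_coinv_iff] at hX ⊢
  intro h
  rw [hM.rightComp_mul_of (hM.rightComp_mul_of (fun g => hM.rightComp_ι g f) hX)
    (fun g => hM.rightComp_ι g f⁻¹), mul_one, mul_inv_cancel]

theorem antipode_mem_coinv (hM : IsGradedPointedMajid A 𝓜 ι) (x : G) (X : M) :
    A.mul (ι x) (A.antipode (hM.leftComp x X)) ∈ coinv 𝓜 A := by
  classical
  rw [hM.mem_coinv_iff]
  intro h
  rw [hM.rightComp_mul_of (fun g => hM.rightComp_ι g x) (y := x⁻¹) fun g => ?_, mul_inv_cancel]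
  rw [rightComp_antipode, leftComp_leftComp]
  by_cases h : g = x⁻¹
  · simp [h]
  · rw [if_neg (fun h' => h (by rw [h', inv_inv])), if_neg h, map_zero]

/-- The endomorphism of `M` whose restriction to `R` is the action of `f`: for `X` in `R` of
degree `g`, `f ▷ X = Φ(fg,f⁻¹,f) / Φ(f,f⁻¹,f) (f · X) · f⁻¹`. -/
noncomputable def actM (hM : IsGradedPointedMajid A 𝓜 ι) (f : G) : M →ₗ[k] M :=
  ∑ g, (groupAssoc A ι (f * g) f⁻¹ f / groupAssoc A ι f f⁻¹ f) •
    (A.mul.flip (ι f⁻¹) ∘ₗ A.mul (ι f) ∘ₗ hM.leftComp g)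

/-- `X ↦ Φ(x₁,x₂,x₂⁻¹) X₁ · x₂⁻¹ ⊗ X₂`, where `Δ(X) = X₁ ⊗ X₂` with `X₂` of (left) degree `x₂` and
`X₁` of (left) degree `x₁x₂`, so that `X₁ · x₂⁻¹` has degree `x₁`. -/
noncomputable def comulM (hM : IsGradedPointedMajid A 𝓜 ι) : M →ₗ[k] M ⊗[k] M :=
  ∑ x₁, ∑ x₂, groupAssoc A ι x₁ x₂ x₂⁻¹ •
    (TensorProduct.map (A.mul.flip (ι x₂⁻¹) ∘ₗ hM.leftComp (x₁ * x₂)) (hM.leftComp x₂) ∘ₗ A.comul)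

/-- `X ↦ Φ(x,x⁻¹,x)⁻¹ x · S(X)` for `X` of degree `x`. -/
noncomputable def antipodeM (hM : IsGradedPointedMajid A 𝓜 ι) : M →ₗ[k] M :=
  ∑ x, (groupAssoc A ι x x⁻¹ x)⁻¹ • (A.mul (ι x) ∘ₗ A.antipode ∘ₗ hM.leftComp x)

/-- The braided Hopf algebra structure on the coinvariants `R` of `M`: the degree is given by the
left `kG`-coaction `(π ⊗ id) Δ`, the product, unit and counit are those of `M`, the action, coproduct
and antipode are given by the formulas above. -/
noncomputable def coinvData (hM : IsGradedPointedMajid A 𝓜 ι) : YDHopfData k G (coinv 𝓜 A) where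
  comp g := (hM.leftComp g).restrict fun _ hX => hM.leftComp_mem_coinv g hX
  act f := (hM.actM f).restrict fun X hX => by
    simp only [actM, LinearMap.sum_apply, LinearMap.smul_apply]
    exact Submodule.sum_mem _ fun g _ => Submodule.smul_mem _ _
      (hM.conj_mem_coinv f (hM.leftComp_mem_coinv g hX))
  mul := LinearMap.mk₂ k (fun X Y => ⟨A.mul X Y, hM.mul_mem_coinv X.2 Y.2⟩)
    (fun _ _ _ => Subtype.ext (by simp)) (fun _ _ _ => Subtype.ext (by simp))
    (fun _ _ _ => Subtype.ext (by simp)) (fun _ _ _ => Subtype.ext (by simp))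
  one := ⟨A.one, hM.one_mem_coinv⟩
  comul := TensorProduct.map hM.toCoinv hM.toCoinv ∘ₗ hM.comulM ∘ₗ (coinv 𝓜 A).subtype
  counit := A.counit ∘ₗ (coinv 𝓜 A).subtype
  antipode := hM.antipodeM.restrict fun X _ => by
    simp only [antipodeM, LinearMap.sum_apply, LinearMap.smul_apply]
    exact Submodule.sum_mem _ fun g _ => Submodule.smul_mem _ _ (hM.antipode_mem_coinv g X)

/-- The map `comulM` sends `R` to `R ⊗ R`, so that the coproduct of `R` is its restriction. -/
theorem coe_coinvData_comul (hM : IsGradedPointedMajid A 𝓜 ι) (X : coinv 𝓜 A) :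
    TensorProduct.map (coinv 𝓜 A).subtype (coinv 𝓜 A).subtype (hM.coinvData.comul X) =
      hM.comulM X := by
  classical
  have h0 : (coinv 𝓜 A).subtype ∘ₗ hM.toCoinv = hM.rightComp 1 := rfl
  have h1 : ∀ x₁ x₂ : G, hM.rightComp 1 ∘ₗ A.mul.flip (ι x₂⁻¹) ∘ₗ hM.leftComp (x₁ * x₂) =
      (A.mul.flip (ι x₂⁻¹) ∘ₗ hM.leftComp (x₁ * x₂)) ∘ₗ hM.rightComp x₂ := by
    intro x₁ x₂
    ext m
    simp only [LinearMap.comp_apply, LinearMap.flip_apply, rightComp_mul]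
    rw [Finset.sum_eq_single x₂]
    · rw [mul_one, rightComp_ι, if_pos rfl, rightComp_leftComp]
    · intro f _ hf
      rw [mul_one, rightComp_ι, if_neg (by simpa using hf), map_zero]
    · simp
  have h2 : ∀ x₂ : G, hM.rightComp 1 ∘ₗ hM.leftComp x₂ = hM.leftComp x₂ ∘ₗ hM.rightComp 1 :=
    fun x₂ => LinearMap.ext fun m => hM.rightComp_leftComp _ _ _
  have h3 : (hM.rightComp 1).lTensor M (A.comul X) = A.comul (X : M) := by
    rw [← comul_rightComp, hM.mem_coinv_iff.1 X.2 1, if_pos rfl]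
  change TensorProduct.map _ _ (TensorProduct.map _ _ (hM.comulM X)) = _
  rw [← LinearMap.comp_apply, ← TensorProduct.map_comp, h0]
  simp only [comulM, LinearMap.sum_apply, LinearMap.smul_apply, map_sum, map_smul]
  refine Finset.sum_congr rfl fun x₁ _ => Finset.sum_congr rfl fun x₂ _ => congrArg _ ?_
  rw [LinearMap.comp_apply, ← LinearMap.comp_apply, ← TensorProduct.map_comp, h1, h2,
    TensorProduct.map_comp, LinearMap.comp_apply]
  have h4 : TensorProduct.map (hM.rightComp x₂) (hM.rightComp 1) (A.comul X) =
      (hM.rightComp x₂).rTensor M (A.comul (X : M)) := by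
    rw [← LinearMap.rTensor_comp_lTensor, LinearMap.comp_apply, h3]
  rw [h4, rTensor_rightComp, ← LinearMap.comp_apply, LinearMap.map_comp_lTensor]
  congr 2
  ext m
  simp [leftComp_leftComp]

end IsGradedPointedMajid

end Coinvariants

end QuasiBoson

set_option linter.unusedSectionVars false

/-! The coproduct followed by `π` on either side makes `M` a `kG`-bicomodule, so `M` is the sum of
its components of bidegree `(l, r)`. The product multiplies bidegrees, `S` sends `(l, r)` to `(r⁻¹,
l⁻¹)`, and the coproduct sends `(l, r)` into the sum over `m` of `(l, m) ⊗ (m, r)`. The coinvariants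
`R` are the part of right degree `1`.

The functionals `Φ`, `α`, `β`, `ε` vanish in positive length, so on a bihomogeneous element `a` they
see only `π(a) = ε(a) l = ε(a) r`. Quasi-associativity then becomes `Φ(r,r',r'') a(bc) = Φ(l,l',l'')
(ab)c` (`IsBi.mul_mul`): rebracketing costs a nonzero scalar. In particular right multiplication by
`g` is invertible on bihomogeneous elements, and since it shifts the right degree by `g`, every
element of right degree `g` is uniquely `X · g` with `X` in `R`. This gives bijectivity of `F`.

Compatibility with the product is a chain of four rebracketings (`IsBi.mul_ι_mul_mul_ι`), and
compatibility with the coproduct is one rebracketing and one instance of the cocycle identity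
(`IsBi.smul_mul_ι_inv_mul_ι`). The antipode needs more, namely a comparison of `S(a · g)` with `g⁻¹
· S(a)`. This is the classical argument that a left and a right convolution inverse coincide, with
scalar weights correcting for `β` and for the associator (`IsBi.antipode_mul_ι`).

Once `F` respects all structure maps, the axioms for `R # kG` are pulled back from `M`
(`MajidData.IsIso.isMajidAlgebra`); braided Hopf algebra axioms for `R` never have to be verified.
-/

namespace QuasiBoson

/-! ### Transport of the Majid axioms along an isomorphism. -/

section Transport

variable {k : Type*} [Field k] {V : Type*} [AddCommGroup V] [Module k V]
  {W : Type*} [AddCommGroup W] [Module k W]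

/-- The image of a Sweedler presentation under a map of coalgebras. -/
def Sweedler2.map {δ : V →ₗ[k] V ⊗[k] V} {δ' : W →ₗ[k] W ⊗[k] W} {F : V →ₗ[k] W}
    (h : ∀ a, δ' (F a) = TensorProduct.map F F (δ a)) {a : V} (s : Sweedler2 δ a) :
    Sweedler2 δ' (F a) where
  n := s.n
  x₁ i := F (s.x₁ i)
  x₂ i := F (s.x₂ i)
  eq := by simp [h, s.eq]

theorem lTensor_map_of_comul {δ : V →ₗ[k] V ⊗[k] V} {δ' : W →ₗ[k] W ⊗[k] W} {F : V →ₗ[k] W}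
    (h : ∀ a, δ' (F a) = TensorProduct.map F F (δ a))
    {U U' : Type*} [AddCommGroup U] [Module k U] [AddCommGroup U'] [Module k U'] (f : U →ₗ[k] U')
    (t : U ⊗[k] V) :
    δ'.lTensor U' (TensorProduct.map f F t) =
      TensorProduct.map f (TensorProduct.map F F) (δ.lTensor U t) := by
  induction t with
  | zero => simp
  | tmul a b => simp [h]
  | add a b ha hb => simp only [map_add, ha, hb]

theorem rTensor_map_of_comul {δ : V →ₗ[k] V ⊗[k] V} {δ' : W →ₗ[k] W ⊗[k] W} {F : V →ₗ[k] W}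
    (h : ∀ a, δ' (F a) = TensorProduct.map F F (δ a)) (t : V ⊗[k] V) :
    δ'.rTensor W (TensorProduct.map F F t) =
      TensorProduct.map (TensorProduct.map F F) F (δ.rTensor V t) := by
  induction t with
  | zero => simp
  | tmul a b => simp [h]
  | add a b ha hb => simp only [map_add, ha, hb]

/-- The image of a Sweedler presentation under a map of coalgebras. -/
def Sweedler3.map {δ : V →ₗ[k] V ⊗[k] V} {δ' : W →ₗ[k] W ⊗[k] W} {F : V →ₗ[k] W}
    (h : ∀ a, δ' (F a) = TensorProduct.map F F (δ a)) {a : V} (s : Sweedler3 δ a) :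
    Sweedler3 δ' (F a) where
  n := s.n
  x₁ i := F (s.x₁ i)
  x₂ i := F (s.x₂ i)
  x₃ i := F (s.x₃ i)
  eq := by rw [h, lTensor_map_of_comul h, s.eq]; simp

/-- The image of a Sweedler presentation under a map of coalgebras. -/
def Sweedler5.map {δ : V →ₗ[k] V ⊗[k] V} {δ' : W →ₗ[k] W ⊗[k] W} {F : V →ₗ[k] W}
    (h : ∀ a, δ' (F a) = TensorProduct.map F F (δ a)) {a : V} (s : Sweedler5 δ a) :
    Sweedler5 δ' (F a) where
  n := s.n
  x₁ i := F (s.x₁ i)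
  x₂ i := F (s.x₂ i)
  x₃ i := F (s.x₃ i)
  x₄ i := F (s.x₄ i)
  x₅ i := F (s.x₅ i)
  eq := by
    have h2 : ∀ t : V ⊗[k] (V ⊗[k] V), (δ'.lTensor W).lTensor W
        (TensorProduct.map F (TensorProduct.map F F) t) =
        TensorProduct.map F (TensorProduct.map F (TensorProduct.map F F))
          ((δ.lTensor V).lTensor V t) := by
      intro t
      induction t with
      | zero => simp
      | tmul a b => simp [lTensor_map_of_comul h]
      | add a b ha hb => simp only [map_add, ha, hb]
    have h3 : ∀ t : V ⊗[k] (V ⊗[k] (V ⊗[k] V)), ((δ'.lTensor W).lTensor W).lTensor W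
        (TensorProduct.map F (TensorProduct.map F (TensorProduct.map F F)) t) =
        TensorProduct.map F (TensorProduct.map F (TensorProduct.map F (TensorProduct.map F F)))
          (((δ.lTensor V).lTensor V).lTensor V t) := by
      intro t
      induction t with
      | zero => simp
      | tmul a b =>
        simp only [LinearMap.lTensor_tmul, TensorProduct.map_tmul]
        congr 1
        induction b with
        | zero => simp
        | tmul a b => simp [lTensor_map_of_comul h]
        | add a b ha hb => simp only [map_add, ha, hb]
      | add a b ha hb => simp only [map_add, ha, hb]
    rw [h, lTensor_map_of_comul h, h2, h3, s.eq]
    simp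

/-- The axioms of a Majid algebra are invariant under isomorphism. -/
theorem MajidData.IsIso.isMajidAlgebra {A : MajidData k V} {B : MajidData k W} {F : V ≃ₗ[k] W}
    (hF : A.IsIso B F) (hB : B.IsMajidAlgebra) : A.IsMajidAlgebra where
  coassoc := by
    ext a
    have h := LinearMap.congr_fun hB.coassoc (F a)
    simp only [LinearMap.comp_apply, LinearEquiv.coe_coe, hF.map_comul] at h ⊢
    rw [rTensor_map_of_comul (F := F.toLinearMap) hF.map_comul,
      lTensor_map_of_comul (F := F.toLinearMap) hF.map_comul] at h
    apply (TensorProduct.congr F (TensorProduct.congr F F)).injective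
    have h1 : ∀ t : (V ⊗[k] V) ⊗[k] V, TensorProduct.assoc k W W W (TensorProduct.map
        (TensorProduct.map F.toLinearMap F.toLinearMap) F.toLinearMap t) =
        TensorProduct.map F.toLinearMap (TensorProduct.map F.toLinearMap F.toLinearMap)
          (TensorProduct.assoc k V V V t) := fun t => by
      rw [TensorProduct.map_map_assoc]
    rw [h1] at h
    exact h
  counit_left a := by
    apply F.injective
    have h : ∀ t : V ⊗[k] V, F (TensorProduct.lid k V (A.counit.rTensor V t)) =
        TensorProduct.lid k W (B.counit.rTensor W
          (TensorProduct.map F.toLinearMap F.toLinearMap t)) := by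
      intro t
      induction t with
      | zero => simp
      | tmul a b => simp [hF.map_counit]
      | add a b ha hb => simp only [map_add, ha, hb]
    rw [h, ← hF.map_comul, hB.counit_left]
  counit_right a := by
    apply F.injective
    have h : ∀ t : V ⊗[k] V, F (TensorProduct.rid k V (A.counit.lTensor V t)) =
        TensorProduct.rid k W (B.counit.lTensor W
          (TensorProduct.map F.toLinearMap F.toLinearMap t)) := by
      intro t
      induction t with
      | zero => simp
      | tmul a b => simp [hF.map_counit]
      | add a b ha hb => simp only [map_add, ha, hb]
    rw [h, ← hF.map_comul, hB.counit_right]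
  comul_mul a b s t := by
    apply (TensorProduct.congr F F).injective
    have h := hB.comul_mul (F a) (F b) (s.map (F := F.toLinearMap) hF.map_comul)
      (t.map (F := F.toLinearMap) hF.map_comul)
    rw [← hF.map_mul, hF.map_comul] at h
    simp only [map_sum, TensorProduct.congr_tmul, hF.map_mul]
    -- The legs of a mapped presentation are definitionally `F` of the original legs, so `h` is
    -- already the goal; the other Sweedler identities below are closed in the same way.
    exact h
  counit_mul a b := by
    rw [← hF.map_counit, hF.map_mul, hB.counit_mul, hF.map_counit, hF.map_counit]
  comul_one := by
    apply (TensorProduct.congr F F).injective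
    have h := hF.map_comul A.one
    rw [hF.map_one, hB.comul_one] at h
    rw [TensorProduct.congr_tmul, hF.map_one, h]
    rfl
  counit_one := by rw [← hF.map_counit, hF.map_one, hB.counit_one]
  one_mul a := F.injective (by rw [hF.map_mul, hF.map_one, hB.one_mul])
  mul_one a := F.injective (by rw [hF.map_mul, hF.map_one, hB.mul_one])
  quasi_assoc a b c s t u := by
    apply F.injective
    have h := hB.quasi_assoc (F a) (F b) (F c) (s.map (F := F.toLinearMap) hF.map_comul)
      (t.map (F := F.toLinearMap) hF.map_comul) (u.map (F := F.toLinearMap) hF.map_comul)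
    simp only [map_sum, map_smul, hF.map_mul, ← hF.map_assoc]
    exact h
  pentagon a b c d s t u v t' u' := by
    have h := hB.pentagon (F a) (F b) (F c) (F d) (s.map (F := F.toLinearMap) hF.map_comul)
      (t.map (F := F.toLinearMap) hF.map_comul) (u.map (F := F.toLinearMap) hF.map_comul)
      (v.map (F := F.toLinearMap) hF.map_comul) (t'.map (F := F.toLinearMap) hF.map_comul)
      (u'.map (F := F.toLinearMap) hF.map_comul)
    simp only [← hF.map_assoc, hF.map_mul]
    exact h
  assoc_one a b := by
    rw [← hF.map_assoc, hF.map_one, hB.assoc_one, hF.map_counit, hF.map_counit]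
  comul_antipode a := by
    apply (TensorProduct.congr F F).injective
    have h : ∀ t : V ⊗[k] V, TensorProduct.map F.toLinearMap F.toLinearMap
        (TensorProduct.comm k V V (TensorProduct.map A.antipode A.antipode t)) =
        TensorProduct.comm k W W (TensorProduct.map B.antipode B.antipode
          (TensorProduct.map F.toLinearMap F.toLinearMap t)) := by
      intro t
      induction t with
      | zero => simp
      | tmul a b => simp [hF.map_antipode]
      | add a b ha hb => simp only [map_add, ha, hb]
    change TensorProduct.map F.toLinearMap F.toLinearMap _ =
      TensorProduct.map F.toLinearMap F.toLinearMap _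
    rw [h, ← hF.map_comul, ← hF.map_comul, hF.map_antipode, hB.comul_antipode]
  counit_antipode a := by
    rw [← hF.map_counit, hF.map_antipode, hB.counit_antipode, hF.map_counit]
  antipode_alpha a s := by
    apply F.injective
    have h := hB.antipode_alpha (F a) (s.map (F := F.toLinearMap) hF.map_comul)
    rw [hF.map_alpha, ← hF.map_one, ← map_smul] at h
    rw [← h]
    simp only [map_sum, map_smul, hF.map_mul, hF.map_antipode, ← hF.map_alpha]
    rfl
  beta_antipode a s := by
    apply F.injective
    have h := hB.beta_antipode (F a) (s.map (F := F.toLinearMap) hF.map_comul)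
    rw [hF.map_beta, ← hF.map_one, ← map_smul] at h
    rw [← h]
    simp only [map_sum, map_smul, hF.map_mul, hF.map_antipode, ← hF.map_beta]
    rfl
  assoc_antipode a s := by
    have h := hB.assoc_antipode (F a) (s.map (F := F.toLinearMap) hF.map_comul)
    rw [hF.map_counit] at h
    rw [← h]
    simp only [← hF.map_assoc, hF.map_antipode, ← hF.map_alpha, ← hF.map_beta]
    rfl
  assoc_inv := by
    obtain ⟨Ψ, h1, h2, h3⟩ := hB.assoc_inv
    -- The pulled-back inverse is `(a, b, c) ↦ Ψ(F a, F b, F c)`; `lcomp` inserts `F` in the third,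
    -- curried argument.
    refine ⟨(Ψ.compl₁₂ F.toLinearMap F.toLinearMap).compr₂ (LinearMap.lcomp k k F.toLinearMap),
      fun a b c s t u => ?_, fun a b c s t u => ?_, fun a s => ?_⟩
    · have h := h1 (F a) (F b) (F c) (s.map (F := F.toLinearMap) hF.map_comul)
        (t.map (F := F.toLinearMap) hF.map_comul) (u.map (F := F.toLinearMap) hF.map_comul)
      simp only [hF.map_counit] at h
      rw [← h]
      simp only [← hF.map_assoc]
      rfl
    · have h := h2 (F a) (F b) (F c) (s.map (F := F.toLinearMap) hF.map_comul)
        (t.map (F := F.toLinearMap) hF.map_comul) (u.map (F := F.toLinearMap) hF.map_comul)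
      simp only [hF.map_counit] at h
      rw [← h]
      simp only [← hF.map_assoc]
      rfl
    · have h := h3 (F a) (s.map (F := F.toLinearMap) hF.map_comul)
      rw [hF.map_counit] at h
      rw [← h]
      simp only [← hF.map_alpha, ← hF.map_beta, LinearMap.compr₂_apply, LinearMap.compl₁₂_apply,
        LinearMap.lcomp_apply, LinearEquiv.coe_coe, hF.map_antipode]
      rfl

end Transport

end QuasiBoson

namespace QuasiBoson

/-! ### Threefold coproducts and contraction of their middle leg. -/

section Sweedler

variable {k : Type*} [Field k] {V : Type*} [AddCommGroup V] [Module k V]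

theorem Sweedler3.nonempty (δ : V →ₗ[k] V ⊗[k] V) (a : V) : Nonempty (Sweedler3 δ a) := by
  obtain ⟨n, x, t, h⟩ := exists_fin_sum (δ.lTensor V (δ a))
  choose p y z h' using fun i => exists_fin_sum (t i)
  let e := (Fintype.equivFin (Σ i, Fin (p i))).symm
  refine ⟨⟨_, fun i => x (e i).1, fun i => y _ (e i).2, fun i => z _ (e i).2, ?_⟩⟩
  rw [Equiv.sum_comp e (fun q => x q.1 ⊗ₜ[k] (y q.1 q.2 ⊗ₜ[k] z q.1 q.2)), h, Fintype.sum_sigma]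
  refine Finset.sum_congr rfl fun i _ => ?_
  rw [h' i, TensorProduct.tmul_sum]

/-- The quasi-antipode axioms carry `α` or `β` on the middle leg of a threefold coproduct.
Contracting that leg first turns them into sums over an ordinary coproduct. -/
theorem Sweedler3.sum_smul {δ : V →ₗ[k] V ⊗[k] V} {a : V} (s : Sweedler3 δ a) (t : Sweedler2 δ a)
    {W : Type*} [AddCommGroup W] [Module k W] (ψ : V →ₗ[k] k) (B : V →ₗ[k] V →ₗ[k] W) :
    ∑ i, ψ (s.x₂ i) • B (s.x₁ i) (s.x₃ i) =
      ∑ i, B (t.x₁ i) (TensorProduct.lid k V (ψ.rTensor V (δ (t.x₂ i)))) := by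
  have h := congrArg (TensorProduct.lift B ∘
    ((TensorProduct.lid k V).toLinearMap ∘ₗ ψ.rTensor V).lTensor V) s.eq
  simp only [t.eq, Function.comp_apply, map_sum, LinearMap.lTensor_tmul, LinearMap.comp_apply,
    LinearMap.rTensor_tmul, LinearEquiv.coe_coe, TensorProduct.lid_tmul, TensorProduct.lift.tmul,
    map_smul] at h
  exact h.symm

end Sweedler

namespace IsGradedPointedMajid

variable {k : Type*} [Field k] {G : Type*} [CommGroup G] [Fintype G]
  {M : Type*} [AddCommGroup M] [Module k M]
  {A : MajidData k M} {𝓜 : ℕ → Submodule k M} {ι : G → M}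

/-! ### The associator on group-like elements -/

section GroupAssoc

/-- On group-like elements convolution is pointwise multiplication, so a convolution-invertible
functional takes nonzero values there. -/
theorem groupAssoc_ne_zero (hM : IsGradedPointedMajid A 𝓜 ι) (f g h : G) :
    groupAssoc A ι f g h ≠ 0 := by
  obtain ⟨Ψ, h1, -, -⟩ := hM.isMajid.assoc_inv
  have := h1 (ι f) (ι g) (ι h)
    ⟨1, fun _ => ι f, fun _ => ι f, by simp [(hM.isGroupLike f).1]⟩
    ⟨1, fun _ => ι g, fun _ => ι g, by simp [(hM.isGroupLike g).1]⟩
    ⟨1, fun _ => ι h, fun _ => ι h, by simp [(hM.isGroupLike h).1]⟩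
  simp only [Finset.univ_unique, Finset.sum_singleton, (hM.isGroupLike _).2] at this
  intro h0
  rw [← groupAssoc, h0] at this
  simp at this

theorem groupAssoc_pentagon (hM : IsGradedPointedMajid A 𝓜 ι) (a b c d : G) :
    groupAssoc A ι a b (c * d) * groupAssoc A ι (a * b) c d =
      groupAssoc A ι b c d * groupAssoc A ι a (b * c) d * groupAssoc A ι a b c := by
  have := hM.isMajid.pentagon (ι a) (ι b) (ι c) (ι d)
    ⟨1, fun _ => ι a, fun _ => ι a, by simp [(hM.isGroupLike a).1]⟩
    ⟨1, fun _ => ι b, fun _ => ι b, by simp [(hM.isGroupLike b).1]⟩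
    ⟨1, fun _ => ι c, fun _ => ι c, by simp [(hM.isGroupLike c).1]⟩
    ⟨1, fun _ => ι d, fun _ => ι d, by simp [(hM.isGroupLike d).1]⟩
    ⟨1, fun _ => ι b, fun _ => ι b, fun _ => ι b, by simp [(hM.isGroupLike b).1]⟩
    ⟨1, fun _ => ι c, fun _ => ι c, fun _ => ι c, by simp [(hM.isGroupLike c).1]⟩
  simp only [Finset.univ_unique, Finset.sum_singleton, ← hM.ι_mul] at this
  exact this

theorem groupAssoc_one_middle (hM : IsGradedPointedMajid A 𝓜 ι) (f g : G) :
    groupAssoc A ι f 1 g = 1 := by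
  rw [groupAssoc, hM.ι_one, hM.isMajid.assoc_one, (hM.isGroupLike _).2, (hM.isGroupLike _).2,
    _root_.mul_one]

/-- With `1` in the first two places the cocycle identity reads `Φ(1,f,g) = Φ(1,f,g)²`, and the
value is nonzero. -/
theorem groupAssoc_one_left (hM : IsGradedPointedMajid A 𝓜 ι) (f g : G) :
    groupAssoc A ι 1 f g = 1 := by
  have h := hM.groupAssoc_pentagon 1 1 f g
  simp only [_root_.one_mul, hM.groupAssoc_one_middle] at h
  have := hM.groupAssoc_ne_zero 1 f g
  field_simp at h
  exact h.symm

theorem groupAssoc_one_right (hM : IsGradedPointedMajid A 𝓜 ι) (f g : G) :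
    groupAssoc A ι f g 1 = 1 := by
  have h := hM.groupAssoc_pentagon f g 1 1
  simp only [_root_.mul_one, hM.groupAssoc_one_middle] at h
  have := hM.groupAssoc_ne_zero f g 1
  field_simp at h
  simpa using h.symm

theorem beta_ι [DirectSum.Decomposition 𝓜] (hM : IsGradedPointedMajid A 𝓜 ι) (g : G) :
    A.beta (ι g) = (groupAssoc A ι g g⁻¹ g)⁻¹ := by
  have h := hM.isMajid.assoc_antipode (ι g) ⟨1, fun _ => ι g, fun _ => ι g, fun _ => ι g,
    fun _ => ι g, fun _ => ι g, by simp [(hM.isGroupLike g).1]⟩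
  simp only [Finset.univ_unique, Finset.sum_singleton, hM.alpha_ι, _root_.mul_one,
    (hM.isGroupLike _).2] at h
  rw [hM.antipode_ι, mul_comm] at h
  exact eq_inv_of_mul_eq_one_left h

end GroupAssoc

end IsGradedPointedMajid

end QuasiBoson

namespace QuasiBoson

namespace IsGradedPointedMajid

variable {k : Type*} [Field k] {G : Type*} [CommGroup G] [Fintype G]
  {M : Type*} [AddCommGroup M] [Module k M]
  {A : MajidData k M} {𝓜 : ℕ → Submodule k M} {ι : G → M} [DirectSum.Decomposition 𝓜]

/-! ### Bihomogeneous elements -/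

section Bihomogeneous

theorem sum_coeff (hM : IsGradedPointedMajid A 𝓜 ι) (m : M) :
    ∑ g, hM.coeff g m = A.counit m := by
  classical
  suffices h : ∑ g, hM.coeff g = A.counit by simpa using LinearMap.congr_fun h m
  refine hM.lin_ext (fun g => ?_) fun n hn m hm => ?_
  · simp [coeff_ι, (hM.isGroupLike g).2]
  · simp [hM.coeff_of_ne _ hn hm, hM.counit_eq_zero n hn m hm]

theorem sum_leftComp (hM : IsGradedPointedMajid A 𝓜 ι) (m : M) :
    ∑ g, hM.leftComp g m = m := by
  have h : ∀ t : M ⊗[k] M, ∑ g, TensorProduct.lid k M ((hM.coeff g).rTensor M t) =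
      TensorProduct.lid k M (A.counit.rTensor M t) := by
    intro t
    induction t with
    | zero => simp
    | tmul a b => simp [← Finset.sum_smul, sum_coeff]
    | add a b ha hb => simp only [map_add, Finset.sum_add_distrib, ha, hb]
  exact (h _).trans (hM.isMajid.counit_left m)

theorem sum_rightComp (hM : IsGradedPointedMajid A 𝓜 ι) (m : M) :
    ∑ g, hM.rightComp g m = m := by
  have h : ∀ t : M ⊗[k] M, ∑ g, TensorProduct.rid k M ((hM.coeff g).lTensor M t) =
      TensorProduct.rid k M (A.counit.lTensor M t) := by
    intro t
    induction t with
    | zero => simp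
    | tmul a b => simp [← Finset.sum_smul, sum_coeff]
    | add a b ha hb => simp only [map_add, Finset.sum_add_distrib, ha, hb]
  exact (h _).trans (hM.isMajid.counit_right m)

/-- `a` is homogeneous of left degree `l` and of right degree `r`. -/
structure IsBi (hM : IsGradedPointedMajid A 𝓜 ι) (l r : G) (a : M) : Prop where
  left : hM.leftComp l a = a
  right : hM.rightComp r a = a

variable {hM : IsGradedPointedMajid A 𝓜 ι} {l r l' r' l'' r'' : G} {a b c : M}

theorem IsBi.leftComp_eq [DecidableEq G] (h : hM.IsBi l r a) (g : G) :
    hM.leftComp g a = if l = g then a else 0 := by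
  rw [← h.left, leftComp_leftComp]

theorem IsBi.rightComp_eq [DecidableEq G] (h : hM.IsBi l r a) (g : G) :
    hM.rightComp g a = if g = r then a else 0 := by
  have := hM.rightComp_rightComp g r a
  rw [h.right] at this
  rw [this]
  split_ifs with hg
  · rw [hg, h.right]
  · rfl

theorem isBi_comp (hM : IsGradedPointedMajid A 𝓜 ι) (l r : G) (a : M) :
    hM.IsBi l r (hM.leftComp l (hM.rightComp r a)) := by
  classical
  constructor
  · rw [leftComp_leftComp, if_pos rfl]
  · rw [rightComp_leftComp, rightComp_rightComp, if_pos rfl]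

theorem isBi_ι (hM : IsGradedPointedMajid A 𝓜 ι) (g : G) : hM.IsBi g g (ι g) := by
  classical
  constructor
  · simp [leftComp, (hM.isGroupLike g).1, coeff_ι]
  · simp [rightComp_ι]

theorem IsBi.coeff_eq_of_right [DecidableEq G] (h : hM.IsBi l r a) (g : G) :
    hM.coeff g a = if g = r then A.counit a else 0 := by
  have h1 : ∀ g, hM.coeff g a = if g = r then hM.coeff g a else 0 := fun g => by
    rw [← hM.coeff_rightComp, h.right]
  have h2 := hM.sum_coeff a
  rw [Finset.sum_congr rfl fun g _ => h1 g] at h2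
  simp only [Finset.sum_ite_eq', Finset.mem_univ, if_true] at h2
  rw [h1]
  split_ifs with hg
  · rw [hg, h2]
  · rfl

theorem IsBi.coeff_eq_of_left [DecidableEq G] (h : hM.IsBi l r a) (g : G) :
    hM.coeff g a = if l = g then A.counit a else 0 := by
  have h1 : ∀ g, hM.coeff g a = if l = g then hM.coeff l a else 0 := fun g => by
    rw [← hM.coeff_leftComp, h.left]
  have h2 := hM.sum_coeff a
  rw [Finset.sum_congr rfl fun g _ => h1 g] at h2
  simp only [Finset.sum_ite_eq, Finset.mem_univ, if_true] at h2
  rw [h1, h2]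

/-- The degree-zero part of `a` is supported at `l` by the left coaction and at `r` by the right
one. Hence, wherever a factor `ε(a)` occurs, the left and right degrees may be exchanged. -/
theorem IsBi.counit_eq_zero (h : hM.IsBi l r a) (hlr : l ≠ r) : A.counit a = 0 := by
  classical
  have h1 := h.coeff_eq_of_left r
  rwa [h.coeff_eq_of_right, if_pos rfl, if_neg hlr] at h1

theorem IsBi.proj_eq_of_right (h : hM.IsBi l r a) : proj 𝓜 a = A.counit a • ι r := by
  classical
  simp [hM.proj_eq, h.coeff_eq_of_right]

theorem IsBi.proj_eq_of_left (h : hM.IsBi l r a) : proj 𝓜 a = A.counit a • ι l := by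
  classical
  simp [hM.proj_eq, h.coeff_eq_of_left]

theorem leftComp_mul (hM : IsGradedPointedMajid A 𝓜 ι) (g : G) (a b : M) :
    hM.leftComp g (A.mul a b) =
      ∑ f, A.mul (hM.leftComp f a) (hM.leftComp (f⁻¹ * g) b) := by
  obtain ⟨s⟩ := Sweedler2.nonempty A.comul a
  obtain ⟨t⟩ := Sweedler2.nonempty A.comul b
  simp only [leftComp, LinearMap.comp_apply, LinearEquiv.coe_coe,
    hM.isMajid.comul_mul a b s t, s.eq, t.eq, map_sum, LinearMap.rTensor_tmul,
    TensorProduct.lid_tmul, LinearMap.sum_apply, map_smul, LinearMap.smul_apply, coeff_mul,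
    Finset.sum_smul]
  simp only [Finset.smul_sum, smul_smul]
  calc _ = ∑ i, ∑ f, ∑ j, (hM.coeff f (s.x₁ i) * hM.coeff (f⁻¹ * g) (t.x₁ j)) •
        A.mul (s.x₂ i) (t.x₂ j) := Finset.sum_congr rfl fun _ _ => Finset.sum_comm
    _ = ∑ f, ∑ i, ∑ j, (hM.coeff f (s.x₁ i) * hM.coeff (f⁻¹ * g) (t.x₁ j)) •
        A.mul (s.x₂ i) (t.x₂ j) := Finset.sum_comm
    _ = _ := Finset.sum_congr rfl fun _ _ => by
      rw [Finset.sum_comm]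
      exact Finset.sum_congr rfl fun _ _ => Finset.sum_congr rfl fun _ _ => by rw [mul_comm]

theorem IsBi.mul (ha : hM.IsBi l r a) (hb : hM.IsBi l' r' b) :
    hM.IsBi (l * l') (r * r') (A.mul a b) := by
  classical
  constructor
  · rw [leftComp_mul, Finset.sum_eq_single l]
    · rw [ha.left, inv_mul_cancel_left, hb.left]
    · intro f _ hf
      rw [ha.leftComp_eq, if_neg hf.symm, map_zero, LinearMap.zero_apply]
    · simp
  · rw [rightComp_mul, Finset.sum_eq_single r]
    · rw [ha.right, inv_mul_cancel_left, hb.right]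
    · intro f _ hf
      rw [ha.rightComp_eq, if_neg hf, map_zero, LinearMap.zero_apply]
    · simp

theorem leftComp_antipode (hM : IsGradedPointedMajid A 𝓜 ι) (g : G) (a : M) :
    hM.leftComp g (A.antipode a) = A.antipode (hM.rightComp g⁻¹ a) := by
  have h1 : ∀ t : M ⊗[k] M, TensorProduct.lid k M ((hM.coeff g).rTensor M
      (TensorProduct.comm k M M (TensorProduct.map A.antipode A.antipode t))) =
      A.antipode (TensorProduct.rid k M ((hM.coeff g⁻¹).lTensor M t)) := by
    intro t
    induction t with
    | zero => simp
    | tmul a b => simp [coeff_antipode]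
    | add a b ha hb => simp only [map_add, ha, hb]
  have h2 := h1 (A.comul a)
  rw [← hM.isMajid.comul_antipode] at h2
  exact h2

theorem IsBi.antipode (ha : hM.IsBi l r a) : hM.IsBi r⁻¹ l⁻¹ (A.antipode a) := by
  constructor
  · rw [leftComp_antipode, inv_inv, ha.right]
  · rw [rightComp_antipode, inv_inv, ha.left]

variable (hM l r a) in
/-- A Sweedler presentation of the coproduct of an element of left degree `l` and right degree `r`
by bihomogeneous elements. -/
structure BiSweedler extends Sweedler2 A.comul a where
  m : Fin n → G
  bi₁ : ∀ i, hM.IsBi l (m i) (x₁ i)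
  bi₂ : ∀ i, hM.IsBi (m i) r (x₂ i)

/-- By coassociativity (`rTensor_rightComp`), projecting the first leg to right degree `g` is the
same as projecting the second leg to left degree `g`. The inner degrees of the two legs therefore
agree. -/
theorem IsBi.nonempty_biSweedler (ha : hM.IsBi l r a) : Nonempty (hM.BiSweedler l r a) := by
  classical
  obtain ⟨s⟩ := Sweedler2.nonempty A.comul a
  have h1 : ∀ t : M ⊗[k] M, t = ∑ g, (hM.leftComp g).lTensor M t := by
    intro t
    induction t with
    | zero => simp
    | tmul a b => simp [← TensorProduct.tmul_sum, sum_leftComp]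
    | add a b ha hb =>
      simp only [map_add, Finset.sum_add_distrib]
      rw [← ha, ← hb]
  have h2 : A.comul a = ∑ g, TensorProduct.map (hM.leftComp l ∘ₗ hM.rightComp g)
      (hM.leftComp g ∘ₗ hM.rightComp r) (A.comul a) := by
    have h3 : A.comul a = ∑ g, TensorProduct.map (hM.rightComp g) (hM.leftComp g) (A.comul a) := by
      conv_lhs => rw [h1 (A.comul a)]
      refine Finset.sum_congr rfl fun g _ => ?_
      -- Idempotence supplies a second copy of the projection, and that copy is moved across the
      -- tensor sign to become `rightComp g` on the first leg.
      have h4 : hM.leftComp g = hM.leftComp g ∘ₗ hM.leftComp g := by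
        ext m
        rw [LinearMap.comp_apply, leftComp_leftComp, if_pos rfl]
      conv_lhs => rw [h4]
      rw [LinearMap.lTensor_comp_apply, ← rTensor_rightComp, ← LinearMap.comp_apply,
        LinearMap.lTensor_comp_rTensor]
    have h5 : A.comul a = TensorProduct.map (hM.leftComp l) (hM.rightComp r) (A.comul a) := by
      conv_lhs => rw [← ha.left, comul_leftComp, ← ha.right, comul_rightComp]
      rw [← LinearMap.comp_apply, LinearMap.rTensor_comp_lTensor]
    rw [h5]
    conv_lhs => rw [h3, map_sum]
    rw [← h5]
    refine Finset.sum_congr rfl fun g _ => ?_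
    rw [← LinearMap.comp_apply, ← TensorProduct.map_comp]
    congr 2
    ext m
    exact hM.rightComp_leftComp r g m
  let e := (Fintype.equivFin (Fin s.n × G)).symm
  refine ⟨⟨⟨_, fun i => hM.leftComp l (hM.rightComp (e i).2 (s.x₁ (e i).1)),
    fun i => hM.leftComp (e i).2 (hM.rightComp r (s.x₂ (e i).1)), ?_⟩, fun i => (e i).2,
    fun i => hM.isBi_comp _ _ _, fun i => hM.isBi_comp _ _ _⟩⟩
  rw [Equiv.sum_comp e (fun q => hM.leftComp l (hM.rightComp q.2 (s.x₁ q.1)) ⊗ₜ[k]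
    hM.leftComp q.2 (hM.rightComp r (s.x₂ q.1))), h2, s.eq, Fintype.sum_prod_type]
  simp only [map_sum, TensorProduct.map_tmul, LinearMap.comp_apply]
  exact Finset.sum_comm

theorem sum_counit_smul_left (hM : IsGradedPointedMajid A 𝓜 ι) (s : Sweedler2 A.comul a) :
    ∑ i, A.counit (s.x₁ i) • s.x₂ i = a := by
  have := hM.isMajid.counit_left a
  simpa [s.eq] using this

theorem sum_counit_smul_right (hM : IsGradedPointedMajid A 𝓜 ι) (s : Sweedler2 A.comul a) :
    ∑ i, A.counit (s.x₂ i) • s.x₁ i = a := by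
  have := hM.isMajid.counit_right a
  simpa [s.eq] using this

end Bihomogeneous

end IsGradedPointedMajid

end QuasiBoson

namespace QuasiBoson

namespace IsGradedPointedMajid

variable {k : Type*} [Field k] {G : Type*} [CommGroup G] [Fintype G]
  {M : Type*} [AddCommGroup M] [Module k M]
  {A : MajidData k M} {𝓜 : ℕ → Submodule k M} {ι : G → M} [DirectSum.Decomposition 𝓜]
  {hM : IsGradedPointedMajid A 𝓜 ι} {l r l' r' l'' r'' : G} {a b c : M}

/-! ### The associator and the quasi-antipode on bihomogeneous elements -/

section Functionals

theorem proj_of_mem {m : M} (hm : m ∈ 𝓜 0) : proj 𝓜 m = m := by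
  have := proj₀_coe 𝓜 ⟨m, hm⟩
  simp only at this
  simp [proj, this]

theorem proj_of_ne {n : ℕ} (hn : n ≠ 0) {m : M} (hm : m ∈ 𝓜 n) : proj 𝓜 m = 0 := by
  simp [proj, proj₀_of_ne 𝓜 hn hm]

/-- A functional vanishing in positive degrees factors through the projection to degree zero. -/
theorem apply_proj {W : Type*} [AddCommGroup W] [Module k W] {φ : M →ₗ[k] W}
    (h : ∀ n, n ≠ 0 → ∀ m ∈ 𝓜 n, φ m = 0) (m : M) : φ (proj 𝓜 m) = φ m := by
  refine hom_induction 𝓜 (p := fun m => φ (proj 𝓜 m) = φ m) (fun m hm => ?_)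
    (fun n hn m hm => ?_) (fun a b ha hb => by simp only [map_add, ha, hb]) m
  · rw [proj_of_mem hm]
  · rw [proj_of_ne hn hm, map_zero, h n hn m hm]

theorem homogeneous_induction {p : M → Prop} (h : ∀ n, ∀ m ∈ 𝓜 n, p m)
    (hadd : ∀ a b, p a → p b → p (a + b)) (m : M) : p m :=
  hom_induction 𝓜 (h 0) (fun n _ => h n) hadd m

/-- One argument of positive length already makes the total length positive, so `Φ` factors through
`π` in each variable separately. -/
theorem assoc_proj (hM : IsGradedPointedMajid A 𝓜 ι) (a b c : M) :
    A.assoc (proj 𝓜 a) (proj 𝓜 b) (proj 𝓜 c) = A.assoc a b c := by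
  have h1 : ∀ a b c, A.assoc (proj 𝓜 a) b c = A.assoc a b c := fun a b c => by
    refine apply_proj (φ := (A.assoc.flip b).flip c) (fun n hn m hm => ?_) a
    simp only [LinearMap.flip_apply]
    refine homogeneous_induction (𝓜 := 𝓜) (p := fun b => A.assoc m b c = 0) (fun j b hb => ?_)
      (fun b b' hb hb' => by simp only [map_add, LinearMap.add_apply, hb, hb', add_zero]) b
    exact homogeneous_induction (𝓜 := 𝓜) (p := fun c => A.assoc m b c = 0)
      (fun l c hc => hM.assoc_eq_zero n j l (by omega) m hm b hb c hc)
      (fun c c' hc hc' => by simp only [map_add, hc, hc', add_zero]) c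
  have h2 : ∀ a b c, A.assoc a (proj 𝓜 b) c = A.assoc a b c := fun a b c => by
    refine apply_proj (φ := (A.assoc a).flip c) (fun n hn m hm => ?_) b
    simp only [LinearMap.flip_apply]
    refine homogeneous_induction (𝓜 := 𝓜) (p := fun b => A.assoc b m c = 0) (fun j b hb => ?_)
      (fun b b' hb hb' => by simp only [map_add, LinearMap.add_apply, hb, hb', add_zero]) a
    exact homogeneous_induction (𝓜 := 𝓜) (p := fun c => A.assoc b m c = 0)
      (fun l c hc => hM.assoc_eq_zero j n l (by omega) b hb m hm c hc)
      (fun c c' hc hc' => by simp only [map_add, hc, hc', add_zero]) c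
  have h3 : ∀ a b c, A.assoc a b (proj 𝓜 c) = A.assoc a b c := fun a b c => by
    refine apply_proj (φ := A.assoc a b) (fun n hn m hm => ?_) c
    refine homogeneous_induction (𝓜 := 𝓜) (p := fun a => A.assoc a b m = 0) (fun j a ha => ?_)
      (fun b b' hb hb' => by simp only [map_add, LinearMap.add_apply, hb, hb', add_zero]) a
    exact homogeneous_induction (𝓜 := 𝓜) (p := fun b => A.assoc a b m = 0)
      (fun l b hb => hM.assoc_eq_zero j l n (by omega) a ha b hb m hm)
      (fun c c' hc hc' => by simp only [map_add, LinearMap.add_apply, hc, hc', add_zero]) b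
  rw [h1, h2, h3]

/-- Both this form and the one with left degrees are needed: in `quasi_assoc` one side evaluates `Φ`
on second legs, whose right degrees are fixed, and the other on first legs, whose left degrees are
fixed. -/
theorem IsBi.assoc_of_right (ha : hM.IsBi l r a) (hb : hM.IsBi l' r' b) (hc : hM.IsBi l'' r'' c) :
    A.assoc a b c = A.counit a * A.counit b * A.counit c * groupAssoc A ι r r' r'' := by
  rw [← hM.assoc_proj, ha.proj_eq_of_right, hb.proj_eq_of_right, hc.proj_eq_of_right]
  simp only [map_smul, LinearMap.smul_apply, smul_eq_mul, groupAssoc]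
  ring

theorem IsBi.assoc_of_left (ha : hM.IsBi l r a) (hb : hM.IsBi l' r' b) (hc : hM.IsBi l'' r'' c) :
    A.assoc a b c = A.counit a * A.counit b * A.counit c * groupAssoc A ι l l' l'' := by
  rw [← hM.assoc_proj, ha.proj_eq_of_left, hb.proj_eq_of_left, hc.proj_eq_of_left]
  simp only [map_smul, LinearMap.smul_apply, smul_eq_mul, groupAssoc]
  ring

/-- The normalization of `α` on `G` and vanishing in positive length leave no other choice. As a
result `S` is a strict left convolution inverse of the identity. -/
theorem alpha_eq_counit (hM : IsGradedPointedMajid A 𝓜 ι) : A.alpha = A.counit :=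
  hM.lin_ext (fun g => by rw [hM.alpha_ι, (hM.isGroupLike g).2]) fun n hn m hm => by
    rw [hM.alpha_eq_zero n hn m hm, hM.counit_eq_zero n hn m hm]

theorem IsBi.beta_eq (ha : hM.IsBi l r a) :
    A.beta a = A.counit a * (groupAssoc A ι r r⁻¹ r)⁻¹ := by
  rw [← apply_proj hM.beta_eq_zero, ha.proj_eq_of_right, map_smul, smul_eq_mul, hM.beta_ι]

/-- Associativity of the product up to the associator on bihomogeneous elements. -/
theorem IsBi.mul_mul (ha : hM.IsBi l r a) (hb : hM.IsBi l' r' b) (hc : hM.IsBi l'' r'' c) :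
    groupAssoc A ι r r' r'' • A.mul a (A.mul b c) =
      groupAssoc A ι l l' l'' • A.mul (A.mul a b) c := by
  obtain ⟨s⟩ := ha.nonempty_biSweedler
  obtain ⟨t⟩ := hb.nonempty_biSweedler
  obtain ⟨u⟩ := hc.nonempty_biSweedler
  have h := hM.isMajid.quasi_assoc a b c s.toSweedler2 t.toSweedler2 u.toSweedler2
  -- The outer degrees of the legs do not depend on the summation indices, so the values of `Φ` are
  -- constants and the remaining counits collapse the coproducts.
  have h1 := fun i j l => (s.bi₂ i).assoc_of_right (t.bi₂ j) (u.bi₂ l)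
  have h2 := fun i j l => (s.bi₁ i).assoc_of_left (t.bi₁ j) (u.bi₁ l)
  simp only [h1, h2] at h
  convert h using 1
  · conv_lhs => rw [← hM.sum_counit_smul_right s.toSweedler2]
    simp only [map_sum, map_smul, LinearMap.sum_apply, LinearMap.smul_apply, Finset.smul_sum]
    refine Finset.sum_congr rfl fun i _ => ?_
    conv_lhs => rw [← hM.sum_counit_smul_right t.toSweedler2]
    simp only [map_sum, map_smul, LinearMap.sum_apply, LinearMap.smul_apply, Finset.smul_sum]
    refine Finset.sum_congr rfl fun j _ => ?_
    conv_lhs => rw [← hM.sum_counit_smul_right u.toSweedler2]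
    simp only [map_sum, map_smul, Finset.smul_sum, smul_smul]
    refine Finset.sum_congr rfl fun l _ => ?_
    congr 1
    ring
  · conv_lhs => rw [← hM.sum_counit_smul_left s.toSweedler2]
    simp only [map_sum, map_smul, LinearMap.sum_apply, LinearMap.smul_apply, Finset.smul_sum]
    refine Finset.sum_congr rfl fun i _ => ?_
    conv_lhs => rw [← hM.sum_counit_smul_left t.toSweedler2]
    simp only [map_sum, map_smul, LinearMap.sum_apply, LinearMap.smul_apply, Finset.smul_sum]
    refine Finset.sum_congr rfl fun j _ => ?_
    conv_lhs => rw [← hM.sum_counit_smul_left u.toSweedler2]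
    simp only [map_sum, map_smul, Finset.smul_sum, smul_smul]
    refine Finset.sum_congr rfl fun l _ => ?_
    congr 1
    ring

theorem sum_antipode_mul (hM : IsGradedPointedMajid A 𝓜 ι) (s : Sweedler2 A.comul a) :
    ∑ i, A.mul (A.antipode (s.x₁ i)) (s.x₂ i) = A.counit a • A.one := by
  obtain ⟨t⟩ := Sweedler3.nonempty A.comul a
  rw [← hM.alpha_eq_counit, ← hM.isMajid.antipode_alpha a t, hM.alpha_eq_counit]
  have h := t.sum_smul s A.counit (A.mul ∘ₗ A.antipode)
  simp only [hM.isMajid.counit_left, LinearMap.comp_apply] at h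
  exact h.symm

/-- First legs of `Δ(a)` all have left degree `l`, so on them `β` is a constant multiple of `ε`. -/
theorem lid_rTensor_beta (hM : IsGradedPointedMajid A 𝓜 ι) (ha : hM.IsBi l r a) :
    TensorProduct.lid k M (A.beta.rTensor M (A.comul a)) =
      (groupAssoc A ι l l⁻¹ l)⁻¹ • a := by
  obtain ⟨s⟩ := ha.nonempty_biSweedler
  have hb : ∀ i, A.beta (s.x₁ i) = (groupAssoc A ι l l⁻¹ l)⁻¹ * A.counit (s.x₁ i) := fun i => by
    rw [← apply_proj hM.beta_eq_zero, (s.bi₁ i).proj_eq_of_left, map_smul, smul_eq_mul, hM.beta_ι,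
      mul_comm]
  rw [s.eq]
  simp only [map_sum, LinearMap.rTensor_tmul, TensorProduct.lid_tmul, hb, mul_smul]
  rw [← Finset.smul_sum, hM.sum_counit_smul_left]

/-- Absorbing `β` into the second leg leaves a weight depending on the inner degree `s.m i`. It
varies with `i`, so on this side `S` is a convolution inverse only after weighting. -/
theorem BiSweedler.sum_mul_antipode (s : hM.BiSweedler l r a) :
    ∑ i, (groupAssoc A ι (s.m i) (s.m i)⁻¹ (s.m i))⁻¹ • A.mul (s.x₁ i) (A.antipode (s.x₂ i)) =
      A.beta a • A.one := by
  obtain ⟨t⟩ := Sweedler3.nonempty A.comul a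
  rw [← hM.isMajid.beta_antipode a t]
  have h := t.sum_smul s.toSweedler2 A.beta (A.mul.compl₂ A.antipode)
  simp only [hM.lid_rTensor_beta (s.bi₂ _), LinearMap.compl₂_apply, map_smul] at h
  exact h.symm

theorem sum_antipode_mul_ι (hM : IsGradedPointedMajid A 𝓜 ι) (s : Sweedler2 A.comul a) (g : G) :
    ∑ i, A.mul (A.antipode (A.mul (s.x₁ i) (ι g))) (A.mul (s.x₂ i) (ι g)) =
      A.counit a • A.one := by
  have h := hM.isMajid.comul_mul a (ι g) s
    ⟨1, fun _ => ι g, fun _ => ι g, by simp [(hM.isGroupLike g).1]⟩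
  simp only [Finset.univ_unique, Finset.sum_singleton] at h
  have h' := hM.sum_antipode_mul ⟨_, _, _, h⟩
  rwa [hM.isMajid.counit_mul, (hM.isGroupLike g).2, mul_one] at h'

end Functionals

/-! ### Comparison of the antipode of `a · g` with `g⁻¹ · S(a)`. -/

section Antipode

variable (A ι) in
/-- The weight for which `g⁻¹ S(-)` is a right convolution inverse of multiplication by `g`. -/
noncomputable def antipodeWeight (g m : G) : k :=
  (groupAssoc A ι m m⁻¹ m)⁻¹ *
    (groupAssoc A ι (m * g) g⁻¹ m⁻¹ / groupAssoc A ι m g g⁻¹)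

/-- Rebracketing `(a₁g)(g⁻¹S(a₂))` to `a₁S(a₂)` costs a factor in the inner degree and a factor in
the outer degrees. The fraction in `antipodeWeight` cancels the inner one and its first factor is
the weight of `BiSweedler.sum_mul_antipode`, so the sum reduces to `β(a)` times a constant. -/
theorem BiSweedler.sum_weight_smul (ha : hM.IsBi l r a) (s : hM.BiSweedler l r a) (g : G) :
    ∑ i, antipodeWeight A ι g (s.m i) •
        A.mul (A.mul (s.x₁ i) (ι g)) (A.mul (ι g⁻¹) (A.antipode (s.x₂ i))) =
      (antipodeWeight A ι g r * A.counit a) • A.one := by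
  have h : ∀ i, antipodeWeight A ι g (s.m i) •
      A.mul (A.mul (s.x₁ i) (ι g)) (A.mul (ι g⁻¹) (A.antipode (s.x₂ i))) =
      (groupAssoc A ι (l * g) g⁻¹ r⁻¹ / groupAssoc A ι l g g⁻¹) •
        (groupAssoc A ι (s.m i) (s.m i)⁻¹ (s.m i))⁻¹ •
          A.mul (s.x₁ i) (A.antipode (s.x₂ i)) := by
    intro i
    have h1 := ((s.bi₁ i).mul (hM.isBi_ι g)).mul_mul (hM.isBi_ι g⁻¹) (s.bi₂ i).antipode
    have h2 := (s.bi₁ i).mul_mul (hM.isBi_ι g) (hM.isBi_ι g⁻¹)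
    rw [← hM.ι_mul, mul_inv_cancel, hM.ι_one, hM.isMajid.mul_one] at h2
    have h3 : A.mul (A.mul (s.x₁ i) (ι g)) (ι g⁻¹) =
        (groupAssoc A ι (s.m i) g g⁻¹ / groupAssoc A ι l g g⁻¹) • s.x₁ i := by
      rw [div_eq_inv_mul, mul_smul, h2, inv_smul_smul₀ (hM.groupAssoc_ne_zero _ _ _)]
    rw [h3, map_smul, LinearMap.smul_apply, smul_smul] at h1
    rw [antipodeWeight, mul_div_assoc', div_eq_mul_inv, mul_right_comm, mul_smul, h1, smul_smul,
      smul_smul]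
    congr 1
    have := hM.groupAssoc_ne_zero (s.m i) g g⁻¹
    field_simp
  rw [Finset.sum_congr rfl fun i _ => h i, ← Finset.smul_sum, s.sum_mul_antipode, smul_smul]
  congr 1
  rw [ha.beta_eq]
  -- For `l = r` the leftover constant times the value of `β` is exactly the weight at `r`;
  -- otherwise `ε(a) = 0` and both sides vanish.
  rcases eq_or_ne l r with rfl | hlr
  · rw [antipodeWeight]
    ring
  · simp [ha.counit_eq_zero hlr]

variable (hM) in
/-- The map `q ↦ w(n) g⁻¹ S(q)` for `q` of left degree `n`, where the weight `w` depends on the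
left degree `l` of the argument of the antipode. -/
noncomputable def weightedAntipode (g l : G) : M →ₗ[k] M :=
  ∑ n, (antipodeWeight A ι g n * (groupAssoc A ι (l * g)⁻¹ (n * g) (g⁻¹ * n⁻¹))⁻¹) •
    (A.mul (ι g⁻¹) ∘ₗ A.antipode ∘ₗ hM.leftComp n)

theorem IsBi.weightedAntipode_eq (ha : hM.IsBi l r a) (g l' : G) :
    hM.weightedAntipode g l' a =
      (antipodeWeight A ι g l * (groupAssoc A ι (l' * g)⁻¹ (l * g) (g⁻¹ * l⁻¹))⁻¹) •
        A.mul (ι g⁻¹) (A.antipode a) := by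
  classical
  simp only [weightedAntipode, LinearMap.sum_apply, LinearMap.smul_apply, LinearMap.comp_apply,
    ha.leftComp_eq]
  rw [Finset.sum_eq_single l]
  · rw [if_pos rfl]
  · intro n _ hn
    rw [if_neg hn.symm, map_zero, map_zero, smul_zero]
  · simp

/-- With brackets to the left, coassociativity isolates `S(a₁g)(a₂g)`, which collapses to a counit.
This works for any linear `D`. -/
theorem sum_sum_antipode_mul_weighted (hM : IsGradedPointedMajid A 𝓜 ι) (g : G) (D : M →ₗ[k] M)
    (s : Sweedler2 A.comul a) (t : ∀ i, Sweedler2 A.comul (s.x₂ i)) :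
    ∑ i, ∑ j, A.mul (A.mul (A.antipode (A.mul (s.x₁ i) (ι g))) (A.mul ((t i).x₁ j) (ι g)))
      (D ((t i).x₂ j)) = D a := by
  let B : M ⊗[k] M →ₗ[k] M :=
    TensorProduct.lift (A.mul.compl₁₂ (A.antipode ∘ₗ A.mul.flip (ι g)) (A.mul.flip (ι g)))
  let Θ : (M ⊗[k] M) ⊗[k] M →ₗ[k] M := TensorProduct.lift (A.mul.compl₁₂ B D)
  have h := LinearMap.congr_fun hM.isMajid.coassoc a
  simp only [LinearMap.comp_apply, LinearEquiv.coe_coe] at h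
  rw [← LinearEquiv.eq_symm_apply] at h
  have h1 := congrArg Θ h
  have hB : ∀ x, B (A.comul x) = A.counit x • A.one := fun x => by
    obtain ⟨u⟩ := Sweedler2.nonempty A.comul x
    rw [← hM.sum_antipode_mul_ι u g, u.eq, map_sum]
    rfl
  have h2 : Θ (A.comul.rTensor M (A.comul a)) = D a := by
    conv_rhs => rw [← hM.sum_counit_smul_left s]
    rw [s.eq]
    simp only [map_sum, LinearMap.rTensor_tmul, Θ, TensorProduct.lift.tmul,
      LinearMap.compl₁₂_apply, hB, map_smul, LinearMap.smul_apply, hM.isMajid.one_mul]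
  rw [← h2, h1, s.eq]
  simp only [map_sum, LinearMap.lTensor_tmul, (t _).eq, TensorProduct.tmul_sum,
    TensorProduct.assoc_symm_tmul]
  rfl

/-- The antipode of `a · g` is `g⁻¹ · S(a)` up to a scalar. -/
theorem IsBi.antipode_mul_ι (ha : hM.IsBi l r a) (g : G) :
    (antipodeWeight A ι g r * (groupAssoc A ι (r * g)⁻¹ (r * g) (g⁻¹ * r⁻¹))⁻¹) •
        A.antipode (A.mul a (ι g)) =
      (antipodeWeight A ι g l * (groupAssoc A ι (l * g)⁻¹ (l * g) (g⁻¹ * l⁻¹))⁻¹) •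
        A.mul (ι g⁻¹) (A.antipode a) := by
  obtain ⟨s⟩ := ha.nonempty_biSweedler
  have t : ∀ i, hM.BiSweedler (s.m i) r (s.x₂ i) := fun i => (s.bi₂ i).nonempty_biSweedler.some
  -- The triple sum `(S(a₁g)(a₂g)) D(a₃)`, with `D = weightedAntipode g l`, is computed in two ways:
  -- bracketed to the left it is `D(a)`, and bracketed to the right it will be a multiple of
  -- `S(ag)`.
  rw [← ha.weightedAntipode_eq, ← hM.sum_sum_antipode_mul_weighted g _ s.toSweedler2
    fun i => (t i).toSweedler2]
  have h1 : ∀ i j, A.mul (A.mul (A.antipode (A.mul (s.x₁ i) (ι g))) (A.mul ((t i).x₁ j) (ι g)))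
      (hM.weightedAntipode g l ((t i).x₂ j)) =
      (groupAssoc A ι (s.m i * g)⁻¹ (s.m i * g) (g⁻¹ * r⁻¹))⁻¹ •
        A.mul (A.antipode (A.mul (s.x₁ i) (ι g))) (antipodeWeight A ι g ((t i).m j) •
          A.mul (A.mul ((t i).x₁ j) (ι g)) (A.mul (ι g⁻¹) (A.antipode ((t i).x₂ j)))) := by
    intro i j
    -- The right degree of `S(a₁g)` is `(lg)⁻¹` for every `i`. Hence a single map `D`, depending
    -- only on `g` and `l`, can cancel the right-degree value of `Φ`.
    have h := ((s.bi₁ i).mul (hM.isBi_ι g)).antipode.mul_mul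
      (((t i).bi₁ j).mul (hM.isBi_ι g)) ((hM.isBi_ι g⁻¹).mul ((t i).bi₂ j).antipode)
    rw [((t i).bi₂ j).weightedAntipode_eq, map_smul, map_smul, mul_smul, smul_comm _
      (antipodeWeight A ι g _)]
    congr 1
    rw [inv_smul_eq_iff₀ (hM.groupAssoc_ne_zero _ _ _), smul_comm, h,
      inv_smul_smul₀ (hM.groupAssoc_ne_zero _ _ _)]
  have h2 : ∀ i, ∑ j, A.mul (A.mul (A.antipode (A.mul (s.x₁ i) (ι g)))
      (A.mul ((t i).x₁ j) (ι g))) (hM.weightedAntipode g l ((t i).x₂ j)) =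
      (antipodeWeight A ι g r * (groupAssoc A ι (r * g)⁻¹ (r * g) (g⁻¹ * r⁻¹))⁻¹) •
        A.antipode (A.mul (A.counit (s.x₂ i) • s.x₁ i) (ι g)) := by
    intro i
    rw [Finset.sum_congr rfl fun j _ => h1 i j, ← Finset.smul_sum, ← map_sum,
      (t i).sum_weight_smul (s.bi₂ i), map_smul, hM.isMajid.mul_one]
    simp only [map_smul, LinearMap.smul_apply, smul_smul]
    -- The factor `ε(a₂)` kills all terms with inner degree other than `r`, so the remaining value
    -- of `Φ` becomes independent of `i`.
    rcases eq_or_ne (s.m i) r with h | h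
    · rw [h]
      congr 1
      ring
    · simp [(s.bi₂ i).counit_eq_zero h]
  rw [Finset.sum_congr rfl fun i _ => h2 i, ← Finset.smul_sum, ← map_sum,
    ← LinearMap.sum_apply, ← map_sum, hM.sum_counit_smul_right]

end Antipode

end IsGradedPointedMajid

end QuasiBoson

namespace QuasiBoson

namespace IsGradedPointedMajid

variable {k : Type*} [Field k] {G : Type*} [CommGroup G] [Fintype G]
  {M : Type*} [AddCommGroup M] [Module k M]
  {A : MajidData k M} {𝓜 : ℕ → Submodule k M} {ι : G → M} [DirectSum.Decomposition 𝓜]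
  {hM : IsGradedPointedMajid A 𝓜 ι} {x y : G} {X Y : M}

/-! ### Homogeneous coinvariants -/

section HomogeneousCoinvariants

/-- This is rebracketing to `a · (g g⁻¹)`. Both scalars are nonzero, so right multiplication by `g`
can be undone. -/
theorem IsBi.mul_ι_mul_ι_inv {l r : G} {a : M} (ha : hM.IsBi l r a) (g : G) :
    groupAssoc A ι l g g⁻¹ • A.mul (A.mul a (ι g)) (ι g⁻¹) = groupAssoc A ι r g g⁻¹ • a := by
  have h := ha.mul_mul (hM.isBi_ι g) (hM.isBi_ι g⁻¹)
  rwa [← hM.ι_mul, mul_inv_cancel, hM.ι_one, hM.isMajid.mul_one, eq_comm] at h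

theorem IsBi.mul_ι_inv_mul_ι {l r : G} {a : M} (ha : hM.IsBi l r a) (g : G) :
    groupAssoc A ι l g⁻¹ g • A.mul (A.mul a (ι g⁻¹)) (ι g) = groupAssoc A ι r g⁻¹ g • a := by
  simpa using ha.mul_ι_mul_ι_inv g⁻¹

theorem IsBi.actM_eq (hY : hM.IsBi y 1 Y) (f : G) :
    hM.actM f Y = (groupAssoc A ι (f * y) f⁻¹ f / groupAssoc A ι f f⁻¹ f) •
      A.mul (A.mul (ι f) Y) (ι f⁻¹) := by
  classical
  simp only [actM, LinearMap.sum_apply, LinearMap.smul_apply, LinearMap.comp_apply,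
    hY.leftComp_eq, LinearMap.flip_apply]
  rw [Finset.sum_eq_single y]
  · rw [if_pos rfl]
  · intro n _ hn
    rw [if_neg hn.symm, map_zero, map_zero, LinearMap.zero_apply, smul_zero]
  · simp

theorem IsBi.smul {l r : G} {a : M} (ha : hM.IsBi l r a) (c : k) : hM.IsBi l r (c • a) :=
  ⟨by rw [map_smul, ha.left], by rw [map_smul, ha.right]⟩

theorem IsBi.actM (hY : hM.IsBi y 1 Y) (f : G) : hM.IsBi y 1 (hM.actM f Y) := by
  rw [hY.actM_eq]
  have := (((hM.isBi_ι f).mul hY).mul (hM.isBi_ι f⁻¹)).smul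
    (groupAssoc A ι (f * y) f⁻¹ f / groupAssoc A ι f f⁻¹ f)
  rwa [mul_one, mul_inv_cancel, mul_inv_cancel_comm] at this

/-- The action describes the commutation of coinvariants with group-like elements. -/
theorem IsBi.actM_mul_ι (hY : hM.IsBi y 1 Y) (g : G) :
    A.mul (hM.actM g Y) (ι g) = A.mul (ι g) Y := by
  -- The element `gY` has bidegree `(gy, g)`, and the scalars for `((gY)g⁻¹)g` are precisely those
  -- normalizing the action.
  have h := ((hM.isBi_ι g).mul hY).mul_ι_inv_mul_ι g
  rw [mul_one] at h
  rw [hY.actM_eq, map_smul, LinearMap.smul_apply, div_eq_inv_mul, mul_smul, h,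
    inv_smul_smul₀ (hM.groupAssoc_ne_zero _ _ _)]

/-- Each of the four values of `Φ` is the price of one rebracketing on the way from `(Xg)(Yh)`
through `((Xg)Y)h` and `X(gY) = X((g ▷ Y)g)` to `(X(g ▷ Y))(gh)`. The right-degree values are all
`1`, because coinvariants have right degree `1` and `Φ` is normalized. -/
theorem IsBi.mul_ι_mul_mul_ι (hX : hM.IsBi x 1 X) (hY : hM.IsBi y 1 Y) (g h : G) :
    (groupAssoc A ι (x * g) y h * groupAssoc A ι x y g /
      (groupAssoc A ι x g y * groupAssoc A ι (x * y) g h)) •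
        A.mul (A.mul X (hM.actM g Y)) (ι (g * h)) =
      A.mul (A.mul X (ι g)) (A.mul Y (ι h)) := by
  have e1 := (hX.mul (hM.isBi_ι g)).mul_mul hY (hM.isBi_ι h)
  have e2 := hX.mul_mul (hM.isBi_ι g) hY
  have e3 := hX.mul_mul (hY.actM g) (hM.isBi_ι g)
  have e4 := (hX.mul (hY.actM g)).mul_mul (hM.isBi_ι g) (hM.isBi_ι h)
  simp only [one_mul, hM.groupAssoc_one_left, hM.groupAssoc_one_middle, one_smul, ← hM.ι_mul,
    hY.actM_mul_ι] at e1 e2 e3 e4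
  rw [e3] at e2
  have n1 := hM.groupAssoc_ne_zero x g y
  have n2 := hM.groupAssoc_ne_zero (x * y) g h
  have e5 : A.mul (A.mul X (ι g)) Y = ((groupAssoc A ι x g y)⁻¹ * groupAssoc A ι x y g) •
      A.mul (A.mul X (hM.actM g Y)) (ι g) := by
    rw [mul_smul, e2, inv_smul_smul₀ n1]
  rw [e1, e4, e5, map_smul, LinearMap.smul_apply, smul_smul, smul_smul]
  congr 1
  field_simp

theorem IsBi.antipodeM_eq (hX : hM.IsBi x 1 X) :
    hM.antipodeM X = (groupAssoc A ι x x⁻¹ x)⁻¹ • A.mul (ι x) (A.antipode X) := by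
  classical
  simp only [antipodeM, LinearMap.sum_apply, LinearMap.smul_apply, LinearMap.comp_apply,
    hX.leftComp_eq]
  rw [Finset.sum_eq_single x]
  · rw [if_pos rfl]
  · intro n _ hn
    rw [if_neg hn.symm, map_zero, map_zero, smul_zero]
  · simp

theorem IsBi.antipode_mul_ι_eq (hX : hM.IsBi x 1 X) (g : G) :
    (groupAssoc A ι g⁻¹ g g⁻¹ / (groupAssoc A ι (x⁻¹ * g⁻¹) (x * g) g⁻¹ * groupAssoc A ι x g g⁻¹)) •
        A.mul (ι (x⁻¹ * g⁻¹)) (hM.antipodeM X) =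
      A.antipode (A.mul X (ι g)) := by
  have e1 := hX.antipode_mul_ι g
  have e2 := (hM.isBi_ι (x⁻¹ * g⁻¹)).mul_mul (hM.isBi_ι x) hX.antipode
  -- With the first two entries mutually inverse, this cocycle identity factors `Φ((xg)⁻¹, xg,
  -- (xg)⁻¹)`, the scalar coming from `e1`, into values occurring in the goal and in `e2`.
  have e3 := hM.groupAssoc_pentagon (x⁻¹ * g⁻¹) (x * g) g⁻¹ x⁻¹
  have i1 : x⁻¹ * g⁻¹ * x = g⁻¹ := by rw [mul_comm, mul_inv_cancel_left]
  have i2 : x⁻¹ * g⁻¹ * (x * g) = 1 := by rw [← mul_inv, inv_mul_cancel]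
  have i3 : g⁻¹ * x⁻¹ = x⁻¹ * g⁻¹ := mul_comm _ _
  simp only [i1, i2, i3, inv_one, mul_one, one_mul, mul_inv, mul_inv_cancel_right,
    hM.groupAssoc_one_left, hM.groupAssoc_one_right, one_smul, ← hM.ι_mul, antipodeWeight,
    div_one, inv_one] at e1 e2 e3
  have n1 := hM.groupAssoc_ne_zero g⁻¹ g g⁻¹
  have n2 := hM.groupAssoc_ne_zero (x⁻¹ * g⁻¹) x x⁻¹
  have n3 := hM.groupAssoc_ne_zero (x⁻¹ * g⁻¹) (x * g) g⁻¹
  have n4 := hM.groupAssoc_ne_zero (x * g) g⁻¹ x⁻¹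
  have n5 := hM.groupAssoc_ne_zero x g g⁻¹
  have n6 := hM.groupAssoc_ne_zero x x⁻¹ x
  rw [inv_smul_eq_iff₀ n1] at e1
  rw [e1, ← e2, hX.antipodeM_eq, map_smul, e3]
  simp only [smul_smul]
  congr 1
  field_simp

/-- Bidegree `(x₁x₂, x₂)` is that of the first leg of the coproduct of a coinvariant. The factor
`Φ(x₁,x₂,x₂⁻¹)` of `Δ_R` and the factor `Φ(x₁,x₂,g)⁻¹` of the bosonization together undo the detour
through `x₂⁻¹`, by the cocycle identity for `x₁, x₂, x₂⁻¹, x₂g`. -/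
theorem IsBi.smul_mul_ι_inv_mul_ι {x₁ x₂ : G} (hX : hM.IsBi (x₁ * x₂) x₂ X) (g : G) :
    ((groupAssoc A ι x₁ x₂ g)⁻¹ * groupAssoc A ι x₁ x₂ x₂⁻¹) •
        A.mul (A.mul X (ι x₂⁻¹)) (ι (x₂ * g)) =
      A.mul X (ι g) := by
  have e1 := hX.mul_mul (hM.isBi_ι x₂⁻¹) (hM.isBi_ι (x₂ * g))
  have e2 := hM.groupAssoc_pentagon x₁ x₂ x₂⁻¹ (x₂ * g)
  simp only [← hM.ι_mul, inv_mul_cancel_left, mul_inv_cancel, hM.groupAssoc_one_middle,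
    mul_one] at e1 e2
  rw [← smul_right_inj (hM.groupAssoc_ne_zero x₂ x₂⁻¹ (x₂ * g)), e1, smul_smul]
  congr 1
  rw [mul_left_comm, ← e2, inv_mul_cancel_left₀ (hM.groupAssoc_ne_zero _ _ _)]

end HomogeneousCoinvariants

end IsGradedPointedMajid

end QuasiBoson

namespace QuasiBoson

/-! ### The structure maps of the bosonization on elements `X ⊗ g`. -/

section SmashFormulas

variable {k : Type*} [Field k] {G : Type*} [CommGroup G] [Fintype G]
  {H : Type*} [AddCommGroup H] [Module k H]

theorem sum_tenG_atG (u : H ⊗[k] MonoidAlgebra k G) : ∑ g, tenG g (atG g u) = u := by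
  classical
  suffices h : ∑ g : G, tenG g ∘ₗ atG g = (LinearMap.id : H ⊗[k] MonoidAlgebra k G →ₗ[k] _) by
    simpa [LinearMap.sum_apply] using LinearMap.congr_fun h u
  refine TensorProduct.ext' fun X v => ?_
  induction v using MonoidAlgebra.induction_linear with
  | zero => simp
  | add a b ha hb => simp only [TensorProduct.tmul_add, map_add, ha, hb]
  | single g c =>
    have : (MonoidAlgebra.single g c : MonoidAlgebra k G) = c • MonoidAlgebra.single g 1 := by
      simp
    rw [this, TensorProduct.tmul_smul, map_smul, map_smul]
    congr 1
    simp only [LinearMap.sum_apply, LinearMap.comp_apply, atG_tmul, LinearMap.id_apply]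
    rw [Finset.sum_eq_single g]
    · simp [tenG]
    · intro h _ hh
      rw [if_neg hh.symm, map_zero]
    · simp

theorem smash_ext {W : Type*} [AddCommGroup W] [Module k W]
    {φ ψ : H ⊗[k] MonoidAlgebra k G →ₗ[k] W} (h : ∀ g, φ ∘ₗ tenG g = ψ ∘ₗ tenG g) : φ = ψ := by
  ext1
  refine LinearMap.ext fun X => ?_
  ext g
  simpa [tenG] using LinearMap.congr_fun (h g) X

theorem atG_tenG [DecidableEq G] (g h : G) (X : H) :
    atG (k := k) g (tenG h X) = if h = g then X else 0 := atG_tmul g h X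

variable {Φ : G → G → G → k} {R : YDHopfData k G H}

/-- The maps of `smash` are defined as sums over all coefficients; on `X ⊗ g` only the coefficient
at `g` contributes. -/
theorem sum_comp_atG {W : Type*} [AddCommGroup W] [Module k W] (F : G → H →ₗ[k] W) (g : G)
    (X : H) : ∑ h, F h (atG (k := k) h (tenG g X)) = F g X := by
  classical
  rw [Finset.sum_eq_single g]
  · rw [atG_tenG, if_pos rfl]
  · intro h _ hh
    rw [atG_tenG, if_neg hh.symm, map_zero]
  · simp

theorem smash_counit_tenG (g : G) (X : H) : (smash Φ R).counit (tenG g X) = R.counit X := by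
  simp only [smash, LinearMap.sum_apply, LinearMap.comp_apply]
  exact sum_comp_atG (fun _ => R.counit) g X

theorem smash_alpha_tenG (g : G) (X : H) : (smash Φ R).alpha (tenG g X) = R.counit X := by
  simp only [smash, LinearMap.sum_apply, LinearMap.comp_apply]
  exact sum_comp_atG (fun _ => R.counit) g X

theorem smash_beta_tenG (g : G) (X : H) :
    (smash Φ R).beta (tenG g X) = (Φ g g⁻¹ g)⁻¹ * R.counit X := by
  simp only [smash, LinearMap.sum_apply, LinearMap.smul_apply, LinearMap.comp_apply]
  exact sum_comp_atG (fun g => (Φ g g⁻¹ g)⁻¹ • R.counit) g X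

theorem smash_assoc_tenG (g h e : G) (X Y Z : H) :
    (smash Φ R).assoc (tenG g X) (tenG h Y) (tenG e Z) =
      R.counit X * R.counit Y * R.counit Z * Φ g h e := by
  simp only [smash, LinearMap.sum_apply, LinearMap.smul_apply, LinearMap.smulRight_apply,
    LinearMap.comp_apply, smul_eq_mul]
  classical
  simp only [atG_tenG, apply_ite R.counit, map_zero, mul_ite, ite_mul, mul_zero, zero_mul,
    Finset.sum_ite_eq, Finset.mem_univ, if_true]
  ring

/-- Since `YDHopfData` carries no axioms, homogeneity of `X` has to be expressed by the values of
all projections `R.comp z`. -/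
theorem smashMul_tenG [DecidableEq G] {X Y : H} {x y : G}
    (hX : ∀ z, R.comp z X = if x = z then X else 0)
    (hY : ∀ z, R.comp z Y = if y = z then Y else 0) (g h : G) :
    smashMul Φ R (tenG g X) (tenG h Y) =
      (Φ (x * g) y h * Φ x y g / (Φ x g y * Φ (x * y) g h)) •
        tenG (g * h) (R.mul X (R.act g Y)) := by
  simp only [smashMul, LinearMap.sum_apply, LinearMap.smul_apply, LinearMap.compr₂_apply,
    LinearMap.compl₁₂_apply, LinearMap.comp_apply]
  rw [Finset.sum_eq_single g, Finset.sum_eq_single h, Finset.sum_eq_single x,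
    Finset.sum_eq_single y]
  · simp only [atG_tenG, if_pos, hX, hY]
  · intro z _ hz
    simp [atG_tenG, hX, hY, hz.symm]
  · simp
  · intro z _ hz
    simp [atG_tenG, hX, hz.symm]
  · simp
  · intro z _ hz
    simp [atG_tenG, hz.symm]
  · simp
  · intro z _ hz
    simp [atG_tenG, hz.symm]
  · simp

theorem smash_antipode_tenG [DecidableEq G] {X : H} {x : G}
    (hX : ∀ z, R.comp z X = if x = z then X else 0) (g : G) : (smash Φ R).antipode (tenG g X) =
      (Φ g⁻¹ g g⁻¹ / (Φ (x⁻¹ * g⁻¹) (x * g) g⁻¹ * Φ x g g⁻¹)) •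
        smashMul Φ R (tenG (x⁻¹ * g⁻¹) R.one) (tenG 1 (R.antipode X)) := by
  simp only [smash, LinearMap.sum_apply, LinearMap.smul_apply, LinearMap.comp_apply]
  rw [Finset.sum_eq_single g, Finset.sum_eq_single x]
  · simp only [atG_tenG, if_pos, hX]
    rfl
  · intro z _ hz
    simp [atG_tenG, hX, hz.symm]
  · simp
  · intro z _ hz
    simp [atG_tenG, hz.symm]
  · simp

theorem smash_comul_tenG (g : G) (X : H) : (smash Φ R).comul (tenG g X) =
    ∑ x₁, ∑ x₂, (Φ x₁ x₂ g)⁻¹ • TensorProduct.map (tenG (x₂ * g) ∘ₗ R.comp x₁)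
      (tenG g ∘ₗ R.comp x₂) (R.comul X) := by
  simp only [smash, LinearMap.sum_apply, LinearMap.smul_apply, LinearMap.comp_apply]
  have := sum_comp_atG (fun g => ∑ x₁, ∑ x₂, (Φ x₁ x₂ g)⁻¹ •
    TensorProduct.map (tenG (k := k) (x₂ * g) ∘ₗ R.comp x₁) (tenG g ∘ₗ R.comp x₂) ∘ₗ R.comul) g X
  simpa only [LinearMap.sum_apply, LinearMap.smul_apply, LinearMap.comp_apply] using this

end SmashFormulas

end QuasiBoson

namespace QuasiBoson

namespace IsGradedPointedMajid

variable {k : Type*} [Field k] {G : Type*} [CommGroup G] [Fintype G]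
  {M : Type*} [AddCommGroup M] [Module k M]
  {A : MajidData k M} {𝓜 : ℕ → Submodule k M} {ι : G → M} [DirectSum.Decomposition 𝓜]

/-! ### The bosonization isomorphism -/

section Bosonization

/-- Homogeneous coinvariants. -/
theorem isBi_coinv (hM : IsGradedPointedMajid A 𝓜 ι) {x : G} {X : coinv 𝓜 A}
    (hX : hM.leftComp x (X : M) = X) : hM.IsBi x 1 (X : M) :=
  ⟨hX, hM.coe_toCoinv X.2⟩

/-- Left projections preserve `R`, so it is spanned by elements of bidegree `(x, 1)`. Identities of
linear maps need checking only there, where the rebracketing rules apply. -/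
theorem coinv_induction (hM : IsGradedPointedMajid A 𝓜 ι) {W : Type*} [AddCommGroup W]
    [Module k W] {φ ψ : coinv 𝓜 A →ₗ[k] W}
    (h : ∀ x (X : coinv 𝓜 A), hM.IsBi x 1 (X : M) → φ X = ψ X) : φ = ψ := by
  classical
  ext X
  have hX : X = ∑ x, (⟨hM.leftComp x X, hM.leftComp_mem_coinv x X.2⟩ : coinv 𝓜 A) :=
    Subtype.ext (by simp [hM.sum_leftComp])
  rw [hX, map_sum, map_sum]
  exact Finset.sum_congr rfl fun x _ => h x _ (hM.isBi_coinv (by simp [leftComp_leftComp]))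

theorem smash_induction (hM : IsGradedPointedMajid A 𝓜 ι) {W : Type*} [AddCommGroup W]
    [Module k W] {φ ψ : coinv 𝓜 A ⊗[k] MonoidAlgebra k G →ₗ[k] W}
    (h : ∀ g x (X : coinv 𝓜 A), hM.IsBi x 1 (X : M) → φ (tenG g X) = ψ (tenG g X)) : φ = ψ :=
  smash_ext fun g => hM.coinv_induction fun x X hX => h g x X hX

theorem coinvData_comp_eq [DecidableEq G] (hM : IsGradedPointedMajid A 𝓜 ι) {x : G}
    {X : coinv 𝓜 A} (hX : hM.IsBi x 1 (X : M)) (z : G) :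
    hM.coinvData.comp z X = if x = z then X else 0 := by
  refine Subtype.ext ((hX.leftComp_eq z).trans ?_)
  split_ifs <;> rfl

/-- The linear map `X ⊗ g ↦ X · g` from the bosonization of the coinvariants. -/
noncomputable def bosonMap (_ : IsGradedPointedMajid A 𝓜 ι) :
    coinv 𝓜 A ⊗[k] MonoidAlgebra k G →ₗ[k] M :=
  ∑ g, A.mul.flip (ι g) ∘ₗ (coinv 𝓜 A).subtype ∘ₗ atG g

theorem bosonMap_tenG (hM : IsGradedPointedMajid A 𝓜 ι) (g : G) (X : coinv 𝓜 A) :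
    hM.bosonMap (tenG g X) = A.mul X (ι g) := by
  simp only [bosonMap, LinearMap.sum_apply, LinearMap.comp_apply]
  exact sum_comp_atG (fun g => A.mul.flip (ι g) ∘ₗ (coinv 𝓜 A).subtype) g X

theorem IsBi.eq_zero_of_mul_ι {hM : IsGradedPointedMajid A 𝓜 ι} {l r : G} {a : M}
    (ha : hM.IsBi l r a) {g : G} (h : A.mul a (ι g) = 0) : a = 0 := by
  have := ha.mul_ι_mul_ι_inv g
  rw [h, map_zero, LinearMap.zero_apply, smul_zero, eq_comm, smul_eq_zero] at this
  exact this.resolve_left (hM.groupAssoc_ne_zero _ _ _)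

/-- Writing `u = ∑ u_g ⊗ g`, the component of bidegree `(xg, g)` in the image of `u` is `(u_g)_x ·
g`. If it vanishes then so does `(u_g)_x`, because right multiplication by `g` is injective on
bihomogeneous elements. -/
theorem bosonMap_injective (hM : IsGradedPointedMajid A 𝓜 ι) :
    Function.Injective hM.bosonMap := by
  classical
  rw [← LinearMap.ker_eq_bot, LinearMap.ker_eq_bot']
  intro u hu
  rw [← sum_tenG_atG u] at hu ⊢
  simp only [map_sum, bosonMap_tenG] at hu
  refine Finset.sum_eq_zero fun g _ => ?_
  suffices h : ∀ x, hM.leftComp x (atG g u : coinv 𝓜 A) = 0 by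
    have h1 : (atG g u : coinv 𝓜 A) = 0 := Subtype.ext (by
      rw [← hM.sum_leftComp (atG g u : coinv 𝓜 A)]
      exact Finset.sum_eq_zero fun x _ => h x)
    rw [h1, map_zero]
  intro x
  have h0 : ∀ h (X : coinv 𝓜 A), hM.leftComp (x * g) (hM.rightComp g (A.mul X (ι h))) =
      if h = g then A.mul (hM.leftComp x X) (ι g) else 0 := by
    intro h X
    suffices H : hM.leftComp (x * g) ∘ₗ hM.rightComp g ∘ₗ A.mul.flip (ι h) ∘ₗ
        (coinv 𝓜 A).subtype = if h = g then A.mul.flip (ι g) ∘ₗ hM.leftComp x ∘ₗ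
          (coinv 𝓜 A).subtype else 0 by
      have := LinearMap.congr_fun H X
      split_ifs at this ⊢ <;> exact this
    refine hM.coinv_induction fun y X hX => ?_
    have h2 := hX.mul (hM.isBi_ι h)
    rw [one_mul] at h2
    simp only [LinearMap.comp_apply, Submodule.subtype_apply, LinearMap.flip_apply]
    rw [h2.rightComp_eq]
    by_cases hg : h = g
    · subst hg
      simp only [if_true, LinearMap.comp_apply, Submodule.subtype_apply, LinearMap.flip_apply]
      rw [h2.leftComp_eq, hX.leftComp_eq]
      simp only [mul_left_inj]
      split_ifs <;> simp
    · simp [hg, Ne.symm hg]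
  have h1 := congrArg (fun m => hM.leftComp (x * g) (hM.rightComp g m)) hu
  simp only [map_sum, h0, map_zero, Finset.sum_ite_eq', Finset.mem_univ, if_true] at h1
  have h3 : hM.IsBi x 1 (hM.leftComp x (atG g u : coinv 𝓜 A)) := by
    have := hM.isBi_comp x 1 (atG g u : coinv 𝓜 A)
    rwa [show hM.rightComp 1 (atG g u : coinv 𝓜 A) = _ from
      hM.coe_toCoinv (atG g u : coinv 𝓜 A).2] at this
  exact h3.eq_zero_of_mul_ι h1

/-- For `a` of right degree `r` the element `a · r⁻¹` is coinvariant, and multiplying it by `r`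
returns a nonzero multiple of `a`. -/
theorem bosonMap_surjective (hM : IsGradedPointedMajid A 𝓜 ι) :
    Function.Surjective hM.bosonMap := by
  classical
  suffices h : ∀ l r a, hM.IsBi l r a → a ∈ LinearMap.range hM.bosonMap by
    intro a
    rw [← LinearMap.mem_range, ← hM.sum_rightComp a]
    refine Submodule.sum_mem _ fun r _ => ?_
    rw [← hM.sum_leftComp (hM.rightComp r a)]
    exact Submodule.sum_mem _ fun l _ => h l r _ (hM.isBi_comp l r a)
  intro l r a ha
  have h1 := ha.mul (hM.isBi_ι r⁻¹)
  rw [mul_inv_cancel] at h1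
  have h2 : A.mul a (ι r⁻¹) ∈ coinv 𝓜 A := hM.mem_coinv_iff.2 h1.rightComp_eq
  have h3 := ha.mul_ι_inv_mul_ι r
  rw [← Submodule.smul_mem_iff _ (hM.groupAssoc_ne_zero r r⁻¹ r), ← h3]
  exact Submodule.smul_mem _ _ ⟨tenG r ⟨_, h2⟩, hM.bosonMap_tenG r _⟩

/-- The linear isomorphism `X ⊗ g ↦ X · g` from the bosonization of the coinvariants. -/
noncomputable def bosonEquiv (hM : IsGradedPointedMajid A 𝓜 ι) :
    (coinv 𝓜 A ⊗[k] MonoidAlgebra k G) ≃ₗ[k] M :=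
  LinearEquiv.ofBijective hM.bosonMap ⟨hM.bosonMap_injective, hM.bosonMap_surjective⟩

theorem bosonMap_mul (hM : IsGradedPointedMajid A 𝓜 ι) (u v : coinv 𝓜 A ⊗[k] MonoidAlgebra k G) :
    hM.bosonMap (smashMul (groupAssoc A ι) hM.coinvData u v) =
      A.mul (hM.bosonMap u) (hM.bosonMap v) := by
  classical
  suffices h : (smashMul (groupAssoc A ι) hM.coinvData).compr₂ hM.bosonMap =
      A.mul.compl₁₂ hM.bosonMap hM.bosonMap from LinearMap.congr_fun₂ h u v
  refine hM.smash_induction fun g x X hX => hM.smash_induction fun h y Y hY => ?_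
  simp only [LinearMap.compr₂_apply, LinearMap.compl₁₂_apply, bosonMap_tenG]
  rw [smashMul_tenG (hM.coinvData_comp_eq hX) (hM.coinvData_comp_eq hY), map_smul, bosonMap_tenG]
  exact hX.mul_ι_mul_mul_ι hY g h

theorem bosonMap_antipode (hM : IsGradedPointedMajid A 𝓜 ι)
    (u : coinv 𝓜 A ⊗[k] MonoidAlgebra k G) :
    hM.bosonMap ((smash (groupAssoc A ι) hM.coinvData).antipode u) =
      A.antipode (hM.bosonMap u) := by
  classical
  suffices h : hM.bosonMap ∘ₗ (smash (groupAssoc A ι) hM.coinvData).antipode =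
      A.antipode ∘ₗ hM.bosonMap from LinearMap.congr_fun h u
  refine hM.smash_induction fun g x X hX => ?_
  simp only [LinearMap.comp_apply]
  rw [smash_antipode_tenG (hM.coinvData_comp_eq hX), map_smul, bosonMap_mul, bosonMap_tenG,
    bosonMap_tenG, bosonMap_tenG, hM.ι_one, hM.isMajid.mul_one, ← hX.antipode_mul_ι_eq]
  -- What remains is that the image of `1 ⊗ x⁻¹g⁻¹` is the group-like element itself.
  congr 2
  exact congrArg A.mul (hM.isMajid.one_mul _)

/-- Bihomogeneity of the legs leaves one term per `i` of the double sum over degrees: `x₂ = s.m i`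
and `x₁ = l (s.m i)⁻¹`. -/
theorem BiSweedler.comulM_eq {hM : IsGradedPointedMajid A 𝓜 ι} {l r : G} {a : M}
    (s : hM.BiSweedler l r a) : hM.comulM a =
      ∑ i, groupAssoc A ι (l * (s.m i)⁻¹) (s.m i) (s.m i)⁻¹ •
        (A.mul (s.x₁ i) (ι (s.m i)⁻¹) ⊗ₜ[k] s.x₂ i) := by
  classical
  simp only [comulM, LinearMap.sum_apply, LinearMap.smul_apply, LinearMap.comp_apply, s.eq,
    map_sum, TensorProduct.map_tmul, LinearMap.flip_apply, Finset.smul_sum]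
  rw [Finset.sum_congr rfl fun x₁ _ => Finset.sum_comm, Finset.sum_comm]
  refine Finset.sum_congr rfl fun i _ => ?_
  have h : ∀ x₁ x₂, x₂ ≠ s.m i → groupAssoc A ι x₁ x₂ x₂⁻¹ •
      (A.mul (hM.leftComp (x₁ * x₂) (s.x₁ i)) (ι x₂⁻¹) ⊗ₜ[k] hM.leftComp x₂ (s.x₂ i)) = 0 := by
    intro x₁ x₂ hx
    rw [(s.bi₂ i).leftComp_eq, if_neg hx.symm, TensorProduct.tmul_zero, smul_zero]
  rw [Finset.sum_congr rfl fun x₁ _ => Finset.sum_eq_single (s.m i) (fun x₂ _ => h x₁ x₂)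
    (by simp), Finset.sum_eq_single (l * (s.m i)⁻¹)]
  · rw [inv_mul_cancel_right, (s.bi₁ i).left, (s.bi₂ i).left]
  · intro z _ hz
    rw [(s.bi₁ i).leftComp_eq, if_neg, map_zero, LinearMap.zero_apply,
      TensorProduct.zero_tmul, smul_zero]
    exact fun h' => hz (eq_mul_inv_of_mul_eq h'.symm)
  · simp

theorem bosonMap_comul (hM : IsGradedPointedMajid A 𝓜 ι)
    (u : coinv 𝓜 A ⊗[k] MonoidAlgebra k G) :
    A.comul (hM.bosonMap u) = TensorProduct.map hM.bosonMap hM.bosonMap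
      ((smash (groupAssoc A ι) hM.coinvData).comul u) := by
  classical
  suffices h : A.comul ∘ₗ hM.bosonMap = TensorProduct.map hM.bosonMap hM.bosonMap ∘ₗ
      (smash (groupAssoc A ι) hM.coinvData).comul from LinearMap.congr_fun h u
  refine hM.smash_induction fun g x X hX => ?_
  simp only [LinearMap.comp_apply]
  have h1 : ∀ x₁ h, hM.bosonMap ∘ₗ tenG h ∘ₗ hM.coinvData.comp x₁ =
      (A.mul.flip (ι h) ∘ₗ hM.leftComp x₁) ∘ₗ (coinv 𝓜 A).subtype :=
    fun x₁ h => LinearMap.ext fun Y => hM.bosonMap_tenG h _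
  -- By `coe_coinvData_comul` the computation moves into `M ⊗ M`, where a bihomogeneous presentation
  -- of `Δ(X)` is available although its first legs need not lie in `R`.
  have h3 : ∀ x₁ x₂, TensorProduct.map hM.bosonMap hM.bosonMap (TensorProduct.map
      (tenG (x₂ * g) ∘ₗ hM.coinvData.comp x₁) (tenG g ∘ₗ hM.coinvData.comp x₂)
        (hM.coinvData.comul X)) =
      TensorProduct.map (A.mul.flip (ι (x₂ * g)) ∘ₗ hM.leftComp x₁)
        (A.mul.flip (ι g) ∘ₗ hM.leftComp x₂) (hM.comulM X) := fun x₁ x₂ => by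
    rw [← coe_coinvData_comul, ← LinearMap.comp_apply, ← TensorProduct.map_comp, h1, h1,
      TensorProduct.map_comp, LinearMap.comp_apply]
  obtain ⟨s⟩ := hX.nonempty_biSweedler
  have h2 := hM.isMajid.comul_mul X (ι g) s.toSweedler2
    ⟨1, fun _ => ι g, fun _ => ι g, by simp [(hM.isGroupLike g).1]⟩
  simp only [Finset.univ_unique, Finset.sum_singleton] at h2
  rw [bosonMap_tenG, h2, smash_comul_tenG]
  simp only [map_sum, map_smul, h3]
  rw [s.comulM_eq]
  simp only [map_sum, map_smul, TensorProduct.map_tmul, LinearMap.comp_apply,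
    LinearMap.flip_apply, Finset.smul_sum]
  rw [Finset.sum_congr rfl fun x₁ _ => Finset.sum_comm, Finset.sum_comm]
  refine Finset.sum_congr rfl fun i _ => ?_
  -- The twisted first leg has left degree `x (s.m i)⁻¹`, which selects the single surviving pair of
  -- degrees.
  have h4 := (s.bi₁ i).mul (hM.isBi_ι (s.m i)⁻¹)
  rw [Finset.sum_eq_single (x * (s.m i)⁻¹), Finset.sum_eq_single (s.m i)]
  · have h5 : hM.IsBi (x * (s.m i)⁻¹ * s.m i) (s.m i) (s.x₁ i) := by
      rw [inv_mul_cancel_right]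
      exact s.bi₁ i
    rw [h4.left, (s.bi₂ i).left, smul_smul, TensorProduct.smul_tmul', h5.smul_mul_ι_inv_mul_ι]
  · intro z _ hz
    rw [(s.bi₂ i).leftComp_eq, if_neg hz.symm, map_zero, LinearMap.zero_apply,
      TensorProduct.tmul_zero, smul_zero, smul_zero]
  · simp
  · intro z _ hz
    refine Finset.sum_eq_zero fun z' _ => ?_
    rw [h4.leftComp_eq, if_neg hz.symm, map_zero, LinearMap.zero_apply,
      TensorProduct.zero_tmul, smul_zero, smul_zero]
  · simp

theorem isIso_bosonEquiv (hM : IsGradedPointedMajid A 𝓜 ι) :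
    (smash (groupAssoc A ι) hM.coinvData).IsIso A hM.bosonEquiv where
  map_comul := hM.bosonMap_comul
  map_counit u := by
    change A.counit (hM.bosonMap u) = _
    suffices h : A.counit ∘ₗ hM.bosonMap = (smash (groupAssoc A ι) hM.coinvData).counit from
      LinearMap.congr_fun h u
    refine hM.smash_induction fun g x X hX => ?_
    rw [LinearMap.comp_apply, bosonMap_tenG, smash_counit_tenG, hM.isMajid.counit_mul,
      (hM.isGroupLike g).2, mul_one]
    rfl
  map_mul := hM.bosonMap_mul
  map_one := (hM.bosonMap_tenG 1 _).trans (by rw [hM.ι_one, hM.isMajid.mul_one]; rfl)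
  map_assoc u v w := by
    change A.assoc (hM.bosonMap u) (hM.bosonMap v) (hM.bosonMap w) = _
    suffices h : (A.assoc.compl₁₂ hM.bosonMap hM.bosonMap).compr₂
        (LinearMap.lcomp k k hM.bosonMap) = (smash (groupAssoc A ι) hM.coinvData).assoc from
      LinearMap.congr_fun (LinearMap.congr_fun₂ h u v) w
    refine hM.smash_induction fun g x X hX => hM.smash_induction fun h y Y hY =>
      hM.smash_induction fun e z Z hZ => ?_
    rw [smash_assoc_tenG]
    simp only [LinearMap.compr₂_apply, LinearMap.compl₁₂_apply, LinearMap.lcomp_apply,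
      bosonMap_tenG]
    -- The right degrees are the useful ones here: that of `X · g` is `g`, whereas its left degree
    -- `xg` would bring in the degree of `X`.
    rw [(hX.mul (hM.isBi_ι g)).assoc_of_right (hY.mul (hM.isBi_ι h)) (hZ.mul (hM.isBi_ι e))]
    simp only [hM.isMajid.counit_mul, (hM.isGroupLike _).2, mul_one, one_mul]
    rfl
  map_antipode := hM.bosonMap_antipode
  map_alpha u := by
    change A.alpha (hM.bosonMap u) = _
    suffices h : A.alpha ∘ₗ hM.bosonMap = (smash (groupAssoc A ι) hM.coinvData).alpha from
      LinearMap.congr_fun h u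
    refine hM.smash_induction fun g x X hX => ?_
    rw [LinearMap.comp_apply, bosonMap_tenG, smash_alpha_tenG, hM.alpha_eq_counit,
      hM.isMajid.counit_mul, (hM.isGroupLike g).2, mul_one]
    rfl
  map_beta u := by
    change A.beta (hM.bosonMap u) = _
    suffices h : A.beta ∘ₗ hM.bosonMap = (smash (groupAssoc A ι) hM.coinvData).beta from
      LinearMap.congr_fun h u
    refine hM.smash_induction fun g x X hX => ?_
    rw [LinearMap.comp_apply, bosonMap_tenG, smash_beta_tenG, (hX.mul (hM.isBi_ι g)).beta_eq,
      hM.isMajid.counit_mul, (hM.isGroupLike g).2, mul_one, one_mul, mul_comm]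
    rfl

end Bosonization

end IsGradedPointedMajid

end QuasiBoson

open QuasiBoson in
theorem proposition3p4 {k : Type*} [Field k] [IsAlgClosed k] [CharZero k]
    {G : Type*} [CommGroup G] [Fintype G]
    {M : Type*} [AddCommGroup M] [Module k M] [FiniteDimensional k M]
    (A : MajidData k M) (𝓜 : ℕ → Submodule k M) [DirectSum.Decomposition 𝓜] (ι : G → M)
    (hM : IsGradedPointedMajid A 𝓜 ι) :
    (smash (groupAssoc A ι) hM.coinvData).IsMajidAlgebra ∧
      ∃ F : (coinv 𝓜 A ⊗[k] MonoidAlgebra k G) ≃ₗ[k] M,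
        (∀ (X : coinv 𝓜 A) (g : G), F (X ⊗ₜ[k] MonoidAlgebra.single g 1) = A.mul X (ι g)) ∧
        MajidData.IsIso (smash (groupAssoc A ι) hM.coinvData) A F := by
  exact ⟨hM.isIso_bosonEquiv.isMajidAlgebra hM.isMajid, hM.bosonEquiv,
    fun X g => hM.bosonMap_tenG g X, hM.isIso_bosonEquiv⟩
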